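/- Let $1<p<\infty$, let $q$ be given by $\frac1p+\frac1q=1$, and let $r>1$ be an integer. Let $c_{00}$ be the space of eventually zero real sequences, and for $x\in c_{00}$, $F\subseteq\mathbb N$ let $Fx$ be the restriction of $x$ to the coordinates in $F$. Let $|\cdot|_{p,r}$ be the unique norm on $c_{00}$ such that for all $x\in c_{00}$ $$|x|_{p,r}=\max\Big\{\|x\|_\infty,\ \frac{1}{r^{1/q}}\sup\sum_{i=1}^r|F_ix|_{p,r}\Big\},$$ where the supremum is taken over all $r$-tuples of pairwise disjoint sets $F_1,\dots,F_r\subseteq\mathbb N$; its unique continuous extension to the real space $\ell_p$ is denoted by the same symbol. Then every infinite-dimensional linear subspace $X\subseteq\ell_p$ contains an infinite-dimensional linear subspace $Y\subseteq X$, which can be chosen closed if $X$ is closed, such that for all $x\in Y$ $$4^{-6}\|x\|_p\le(\log_2 r)^{1/p}\,|x|_{p,r}\le 3\cdot4^7(p+q)\|x\|_p .$$ Consequently the stabilization constant of $|\cdot|_{p,r}$ on $\ell_p$, that is, $$\sup_{X}\ \inf_{Y\subseteq X}\ \sup\Big\{\frac{|x|_{p,r}}{|y|_{p,r}}:\ x,y\in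 Y,\ \|x\|_p=\|y\|_p=1\Big\}$$ ($X$ and $Y$ ranging over infinite-dimensional linear subspaces of $\ell_p$), is at most $3\cdot4^{13}(p+q)$. -/

import Mathlib

open scoped ENNReal

noncomputable section

namespace ModifiedTsirelson

/-- The space `c₀₀` of eventually zero real sequences. -/
abbrev C00 := ℕ →₀ ℝ

/-- The real sequence space `ℓ_p`, with its canonical norm. -/
abbrev Ell (p : ℝ) := lp (fun _ : ℕ => ℝ) (ENNReal.ofReal p)

instance factOneLeOfReal (p : ℝ) [hp : Fact (1 < p)] : Fact (1 ≤ ENNReal.ofReal p) :=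
  ⟨by simpa using ENNReal.ofReal_le_ofReal hp.out.le⟩

/-- The supremum norm on `c₀₀`. -/
def supNorm (x : C00) : ℝ := ⨆ i, |x i|

/-- The restriction `E x` of a vector `x` to a set `E` of coordinates. -/
def restr (E : Set ℕ) (x : C00) : C00 := by
  classical exact x.filter (fun i => i ∈ E)

/-- The factor `1 / r^(1/q)`, where `1/p + 1/q = 1`. -/
def theta (p : ℝ) (r : ℕ) : ℝ := 1 / (r : ℝ) ^ (1 / p.conjExponent)

/-- `N` is a norm on `c₀₀` satisfying the implicit equation
`N x = max {‖x‖_∞, r^(-1/q) sup ∑ N (F_i x)}`, the supremum over all `r`-tuples of pairwise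
disjoint sets `F_i` of natural numbers. (For each `x` only finitely many values occur in the
supremum, so that it is finite.) -/
def IsModifiedTsirelsonNorm (p : ℝ) (r : ℕ) (N : Seminorm ℝ C00) : Prop :=
  (∀ x, N x = 0 → x = 0) ∧
  ∀ x, N x = max (supNorm x)
    (theta p r * ⨆ F : {F : Fin r → Set ℕ // Pairwise fun i j => Disjoint (F i) (F j)},
      ∑ i, N (restr (F.1 i) x))

/-- The modified Tsirelson-type norm on `c₀₀`: the unique norm that satisfies the implicit
equation (`existsUnique_isModifiedTsirelsonNorm` below). -/
def c00Norm (p : ℝ) (r : ℕ) : Seminorm ℝ C00 :=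
  Classical.epsilon (IsModifiedTsirelsonNorm p r)

/-- The inclusion of `c₀₀` in `ℓ_p`. -/
def toEll (p : ℝ) (x : C00) : Ell p :=
  ⟨fun i => x i, (memℓp_zero (by
    refine x.support.finite_toSet.subset ?_
    intro i hi
    simpa using hi)).of_exponent_ge (zero_le)⟩

/-- `f` is a continuous extension to `ℓ_p` of the modified Tsirelson-type norm on `c₀₀`. -/
def IsExtension (p : ℝ) [Fact (1 < p)] (r : ℕ) (f : Ell p → ℝ) : Prop :=
  Continuous f ∧ ∀ x : C00, f (toEll p x) = c00Norm p r x

/-- The modified Tsirelson-type norm `|·|_{p,r}` on `ℓ_p`: the unique continuous extension of the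
norm on `c₀₀` (`existsUnique_isExtension` below). -/
def tsirelsonNorm (p : ℝ) [Fact (1 < p)] (r : ℕ) : Ell p → ℝ :=
  Classical.epsilon (IsExtension p r)

/-- The stabilization constant of a function `N` (an equivalent norm) on a normed space `E`: the
infimum of all `c` such that every infinite-dimensional subspace `X` has an infinite-dimensional
subspace `Y` with `N x ≤ c * N y` for all unit vectors `x, y` of `Y`. Equivalently, the supremum
over `X` of the infimum over `Y ⊆ X` of the oscillation ratio of `N` on the unit sphere of `Y`. -/
def stabilizationConstant {E : Type*} [NormedAddCommGroup E] [NormedSpace ℝ E]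
    (N : E → ℝ) : ℝ≥0∞ :=
  ⨆ (X : Submodule ℝ E) (_ : ¬ FiniteDimensional ℝ X),
    ⨅ (Y : Submodule ℝ E) (_ : Y ≤ X) (_ : ¬ FiniteDimensional ℝ Y),
      ⨆ (x : E) (y : E) (_ : x ∈ Y) (_ : y ∈ Y) (_ : ‖x‖ = 1) (_ : ‖y‖ = 1),
        ENNReal.ofReal (N x) / ENNReal.ofReal (N y)

/-! The two uniqueness and existence facts that the definitions rest on. -/

section Facts

theorem restr_apply_mem {E : Set ℕ} {x : C00} {i : ℕ} (h : i ∈ E) : restr E x i = x i := by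
  classical
  simp [restr, h]

theorem restr_apply_not_mem {E : Set ℕ} {x : C00} {i : ℕ} (h : i ∉ E) : restr E x i = 0 := by
  classical
  simp [restr, h]

theorem support_restr_subset (E : Set ℕ) (x : C00) : (restr E x).support ⊆ x.support := by
  intro i hi
  by_cases h : i ∈ E
  · simpa [restr_apply_mem h] using hi
  · simp [restr_apply_not_mem h] at hi

theorem mem_of_mem_support_restr {E : Set ℕ} {x : C00} {i : ℕ} (hi : i ∈ (restr E x).support) :
    i ∈ E := by
  by_contra h
  simp [restr_apply_not_mem h] at hi

theorem theta_pos {p : ℝ} {r : ℕ} (hr : 1 < r) : 0 < theta p r := by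
  have : (0 : ℝ) < r := by exact_mod_cast (by omega : 0 < r)
  unfold theta
  positivity

theorem theta_lt_one {p : ℝ} (hp : 1 < p) {r : ℕ} (hr : 1 < r) : theta p r < 1 := by
  have h1 : (1 : ℝ) < r := by exact_mod_cast hr
  have hq := (Real.HolderConjugate.conjExponent hp).symm.pos
  have : (1 : ℝ) < (r : ℝ) ^ (1 / p.conjExponent) :=
    Real.one_lt_rpow h1 (by positivity)
  unfold theta
  rw [div_lt_one (by positivity)]
  exact this

theorem theta_rpow {p : ℝ} (hp : 1 < p) {r : ℕ} (hr : 1 < r) :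
    theta p r ^ p.conjExponent * r = 1 := by
  have h0 : (0 : ℝ) < r := by exact_mod_cast (by omega : 0 < r)
  have hq := (Real.HolderConjugate.conjExponent hp).symm.pos
  unfold theta
  rw [Real.div_rpow zero_le_one (by positivity), ← Real.rpow_mul h0.le, Real.one_rpow,
    one_div_mul_cancel hq.ne', Real.rpow_one]
  field_simp

theorem abs_le_supNorm (x : C00) (i : ℕ) : |x i| ≤ supNorm x := by
  refine le_ciSup (f := fun i => |x i|) ?_ i
  refine ⟨∑ j ∈ x.support, |x j|, ?_⟩
  rintro _ ⟨j, rfl⟩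
  by_cases hj : j ∈ x.support
  · exact Finset.single_le_sum (f := fun j => |x j|) (fun k _ => abs_nonneg _) hj
  · have : x j = 0 := by simpa using hj
    simp only [this, abs_zero]
    exact Finset.sum_nonneg fun k _ => abs_nonneg _

theorem seminorm_le (N : Seminorm ℝ C00) (x : C00) (s : Finset ℕ) (hs : x.support ⊆ s) :
    N x ≤ ∑ i ∈ s, |x i| * N (Finsupp.single i 1) := by
  have h : x = ∑ i ∈ s, x i • Finsupp.single i (1 : ℝ) := by
    conv_lhs => rw [← Finsupp.sum_single x, Finsupp.sum_of_support_subset x hs _ (by simp)]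
    simp
  conv_lhs => rw [h]
  refine (map_sum_le_sum N _ s).trans (Finset.sum_le_sum fun i _ => ?_)
  rw [map_smul_eq_mul, Real.norm_eq_abs]
where
  map_sum_le_sum (N : Seminorm ℝ C00) (f : ℕ → C00) (s : Finset ℕ) :
      N (∑ i ∈ s, f i) ≤ ∑ i ∈ s, N (f i) := by
    classical
    induction s using Finset.induction_on with
    | empty => simp
    | insert a s ha ih =>
      rw [Finset.sum_insert ha, Finset.sum_insert ha]
      exact (map_add_le_add N _ _).trans (by linarith)

theorem bddAbove_seminorm (N : Seminorm ℝ C00) (r : ℕ) (x : C00) :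
    BddAbove (Set.range fun F : {F : Fin r → Set ℕ // Pairwise fun i j => Disjoint (F i) (F j)} =>
      ∑ i, N (restr (F.1 i) x)) := by
  refine ⟨∑ _i : Fin r, ∑ i ∈ x.support, |x i| * N (Finsupp.single i 1), ?_⟩
  rintro _ ⟨F, rfl⟩
  refine Finset.sum_le_sum fun j _ => ?_
  refine (seminorm_le N _ _ (support_restr_subset _ _)).trans (Finset.sum_le_sum fun i _ => ?_)
  refine mul_le_mul_of_nonneg_right ?_ (apply_nonneg N _)
  by_cases h : i ∈ F.1 j
  · rw [restr_apply_mem h]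
  · rw [restr_apply_not_mem h, abs_zero]
    exact abs_nonneg _

theorem le_of_isModified {p : ℝ} (hp : 1 < p) {r : ℕ} (hr : 1 < r) {N N' : Seminorm ℝ C00}
    (h : IsModifiedTsirelsonNorm p r N) (h' : IsModifiedTsirelsonNorm p r N') (n : ℕ) :
    ∀ x : C00, x.support.card = n → N x ≤ N' x := by
  induction n using Nat.strong_induction_on with
  | _ n ih =>
    intro x hx
    have ht := theta_pos (p := p) hr
    have ht1 := theta_lt_one hp hr
    have hne : Nonempty {F : Fin r → Set ℕ // Pairwise fun i j => Disjoint (F i) (F j)} :=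
      ⟨⟨fun _ => ∅, fun i j _ => disjoint_bot_left⟩⟩
    by_contra hlt
    push Not at hlt
    have hpos : 0 < N x := (apply_nonneg N' x).trans_lt hlt
    have hN := h.2 x
    have hN' := h'.2 x
    have h1 : supNorm x ≤ N' x := by rw [hN']; exact le_max_left _ _
    have hsup : (⨆ F : {F : Fin r → Set ℕ // Pairwise fun i j => Disjoint (F i) (F j)},
        ∑ i, N (restr (F.1 i) x)) ≤ max (N' x / theta p r) (N x) := by
      refine ciSup_le fun F => ?_
      by_cases hF : ∃ i, (restr (F.1 i) x).support = x.support
      · obtain ⟨i, hi⟩ := hF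
        refine le_max_of_le_right ?_
        rw [Finset.sum_eq_single i]
        · have : restr (F.1 i) x = x := by
            ext k
            by_cases hk : k ∈ x.support
            · rw [restr_apply_mem]
              exact mem_of_mem_support_restr (hi ▸ hk)
            · have h0 : x k = 0 := by simpa using hk
              rw [← hi] at hk
              rw [h0]
              simpa using hk
          rw [this]
        · intro j _ hj
          have : restr (F.1 j) x = 0 := by
            ext k
            by_cases hk : k ∈ (restr (F.1 j) x).support
            · have hk1 := mem_of_mem_support_restr hk
              have hk2 := mem_of_mem_support_restr (hi ▸ support_restr_subset _ _ hk :
                k ∈ (restr (F.1 i) x).support)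
              exact absurd hk2 (Set.disjoint_left.1 (F.2 hj) hk1)
            · simpa using hk
          rw [this, map_zero]
        · simp
      · push Not at hF
        refine le_max_of_le_left ?_
        have h2 : ∑ i, N (restr (F.1 i) x) ≤ ∑ i, N' (restr (F.1 i) x) :=
          Finset.sum_le_sum fun i _ => ih _ (hx ▸ Finset.card_lt_card
            ((support_restr_subset _ _).ssubset_of_ne (hF i))) _ rfl
        have h3 := le_ciSup (bddAbove_seminorm N' r x) F
        have h4 : theta p r * _ ≤ N' x := hN'.symm ▸ le_max_right _ _
        rw [le_div_iff₀ ht, mul_comm]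
        exact (mul_le_mul_of_nonneg_left (h2.trans h3) ht.le).trans h4
    have h5 := mul_le_mul_of_nonneg_left hsup ht.le
    rw [mul_max_of_nonneg _ _ ht.le, mul_div_cancel₀ _ ht.ne'] at h5
    have h6 : N x ≤ max (N' x) (theta p r * N x) := by
      conv_lhs => rw [hN]
      exact max_le (le_max_of_le_left h1) h5
    rcases le_max_iff.1 h6 with h7 | h7
    · linarith
    · nlinarith

/-- The norming set used to construct the norm. -/
inductive NormSet (p : ℝ) (r : ℕ) : C00 → Prop
  | single (n : ℕ) (c : ℝ) (hc : |c| ≤ 1) : NormSet p r (Finsupp.single n c)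
  | step (z : Fin r → C00) (hz : ∀ i, NormSet p r (z i))
      (hd : Pairwise fun i j => Disjoint (z i).support (z j).support) :
      NormSet p r (theta p r • ∑ i, z i)

/-- The pairing of a sequence with an element of `c₀₀`. -/
def pair (x : ℕ → ℝ) (y : C00) : ℝ := y.sum fun i c => x i * c

theorem pair_eq (x : ℕ → ℝ) (y : C00) (s : Finset ℕ) (hs : y.support ⊆ s) :
    pair x y = ∑ i ∈ s, x i * y i :=
  Finsupp.sum_of_support_subset y hs _ (by simp)

theorem pair_step (x : ℕ → ℝ) (c : ℝ) {r : ℕ} (z : Fin r → C00) :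
    pair x (c • ∑ i, z i) = c * ∑ i, pair x (z i) := by
  have h (y : C00) : pair x y = Finsupp.linearCombination ℝ x y := by
    simp [pair, Finsupp.linearCombination_apply, mul_comm]
  simp [h, map_sum]

theorem pair_add (x x' : ℕ → ℝ) (y : C00) : pair (x + x') y = pair x y + pair x' y := by
  simp [pair, Finsupp.sum, add_mul, Finset.sum_add_distrib]

theorem pair_smul (c : ℝ) (x : ℕ → ℝ) (y : C00) : pair (c • x) y = c * pair x y := by
  simp [pair, Finsupp.sum, Finset.mul_sum, mul_assoc]

theorem pair_restr (E : Set ℕ) (x y : C00) : pair (restr E x) y = pair x (restr E y) := by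
  rw [pair_eq _ y _ subset_rfl, pair_eq _ _ _ (support_restr_subset E y)]
  refine Finset.sum_congr rfl fun i _ => ?_
  by_cases h : i ∈ E
  · rw [restr_apply_mem h, restr_apply_mem h]
  · rw [restr_apply_not_mem h, restr_apply_not_mem h]; simp

theorem restr_sum_smul (E : Set ℕ) (c : ℝ) {r : ℕ} (z : Fin r → C00) :
    restr E (c • ∑ i, z i) = c • ∑ i, restr E (z i) := by
  ext k
  by_cases h : k ∈ E
  · simp [restr_apply_mem h]
  · simp [restr_apply_not_mem h]

theorem NormSet.restr {p : ℝ} {r : ℕ} {y : C00} (hy : NormSet p r y) (E : Set ℕ) :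
    NormSet p r (restr E y) := by
  induction hy with
  | single n c hc =>
    by_cases h : n ∈ E
    · have : ModifiedTsirelson.restr E (Finsupp.single n c) = Finsupp.single n c := by
        classical
        exact Finsupp.filter_single_of_pos _ h
      rw [this]; exact .single n c hc
    · have : ModifiedTsirelson.restr E (Finsupp.single n c) = Finsupp.single n 0 := by
        classical
        rw [Finsupp.single_zero]
        exact Finsupp.filter_single_of_neg _ h
      rw [this]; exact .single n 0 (by simp)
  | step z _ hd ih =>
    rw [restr_sum_smul]
    exact .step _ ih fun i j hij => (hd hij).mono (support_restr_subset _ _)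
      (support_restr_subset _ _)

theorem NormSet.neg {p : ℝ} {r : ℕ} {y : C00} (hy : NormSet p r y) : NormSet p r (-y) := by
  induction hy with
  | single n c hc => rw [← Finsupp.single_neg]; exact .single n _ (by simpa using hc)
  | step z _ hd ih =>
    rw [← smul_neg, ← Finset.sum_neg_distrib]
    exact .step _ ih fun i j hij => by simpa using hd hij

theorem NormSet.sum_le {p : ℝ} (hp : 1 < p) {r : ℕ} (hr : 1 < r) {y : C00}
    (hy : NormSet p r y) (s : Finset ℕ) : ∑ i ∈ s, |y i| ^ p.conjExponent ≤ 1 := by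
  have hq := (Real.HolderConjugate.conjExponent hp).symm.pos
  induction hy with
  | single n c hc =>
    have h (i : ℕ) : |Finsupp.single n c i| ^ p.conjExponent =
        if i = n then |c| ^ p.conjExponent else 0 := by
      by_cases hi : i = n
      · simp [hi]
      · rw [Finsupp.single_eq_of_ne hi]; simp [hi, Real.zero_rpow hq.ne']
    simp only [h, Finset.sum_ite_eq']
    split_ifs
    · exact Real.rpow_le_one (abs_nonneg _) hc hq.le
    · exact zero_le_one
  | step z _ hd ih =>
    have ht := theta_pos (p := p) hr
    have h (k : ℕ) : |(theta p r • ∑ i, z i) k| ^ p.conjExponent =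
        theta p r ^ p.conjExponent * ∑ i, |z i k| ^ p.conjExponent := by
      rw [Finsupp.smul_apply, Finsupp.finsetSum_apply, smul_eq_mul, abs_mul, abs_of_pos ht,
        Real.mul_rpow ht.le (abs_nonneg _)]
      congr 1
      by_cases hk : ∃ j, z j k ≠ 0
      · obtain ⟨j, hj⟩ := hk
        have h0 : ∀ i, i ≠ j → z i k = 0 := fun i hij => by
          by_contra h0
          exact Finset.disjoint_left.1 (hd hij) (Finsupp.mem_support_iff.2 h0)
            (Finsupp.mem_support_iff.2 hj)
        rw [Finset.sum_eq_single j (fun i _ hi => h0 i hi) (by simp),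
          Finset.sum_eq_single j (fun i _ hi => by
            rw [h0 i hi, abs_zero, Real.zero_rpow hq.ne']) (by simp)]
      · push Not at hk
        simp [hk, Real.zero_rpow hq.ne']
    simp only [h]
    rw [← Finset.mul_sum, Finset.sum_comm]
    calc _ ≤ theta p r ^ p.conjExponent * ∑ _i : Fin r, (1 : ℝ) :=
          mul_le_mul_of_nonneg_left (Finset.sum_le_sum fun i _ => ih i) (by positivity)
      _ = 1 := by simpa using theta_rpow hp hr

theorem pair_le_norm {p : ℝ} [hp : Fact (1 < p)] {r : ℕ} (hr : 1 < r) {y : C00}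
    (hy : NormSet p r y) (x : Ell p) : pair x y ≤ ‖x‖ := by
  have hp0 : 0 < p := zero_lt_one.trans hp.out
  have hto : (ENNReal.ofReal p).toReal = p := ENNReal.toReal_ofReal hp0.le
  rw [pair_eq _ y _ subset_rfl]
  have hc := Real.HolderConjugate.conjExponent hp.out
  refine (Real.inner_le_Lp_mul_Lq _ _ _ hc).trans ?_
  have h1 : (∑ i ∈ y.support, |x i| ^ p) ^ (1 / p) ≤ ‖x‖ := by
    have := lp.sum_rpow_le_norm_rpow (p := ENNReal.ofReal p) (by rw [hto]; exact hp0) x y.support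
    rw [hto] at this
    simp only [Real.norm_eq_abs] at this
    calc _ ≤ (‖x‖ ^ p) ^ (1 / p) := Real.rpow_le_rpow
          (Finset.sum_nonneg fun i _ => by positivity) this (by positivity)
      _ = ‖x‖ := by
        rw [← Real.rpow_mul (norm_nonneg _), mul_one_div_cancel hp0.ne', Real.rpow_one]
  have h2 : (∑ i ∈ y.support, |y i| ^ p.conjExponent) ^ (1 / p.conjExponent) ≤ 1 :=
    Real.rpow_le_one (Finset.sum_nonneg fun i _ => by positivity) (hy.sum_le hp.out hr _)
      (one_div_nonneg.2 hc.symm.pos.le)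
  calc _ ≤ ‖x‖ * 1 := mul_le_mul h1 h2 (Real.rpow_nonneg
        (Finset.sum_nonneg fun i _ => by positivity) _) (norm_nonneg _)
    _ = ‖x‖ := mul_one _

/-- The supremum of the pairings with the norming set. -/
def normingSup (p : ℝ) (r : ℕ) (x : ℕ → ℝ) : ℝ := ⨆ y : {y // NormSet p r y}, pair x y.1

instance normSetNonempty (p : ℝ) (r : ℕ) : Nonempty {y // NormSet p r y} :=
  ⟨⟨_, .single 0 0 (by simp)⟩⟩

theorem pair_le_normingSup {p : ℝ} [Fact (1 < p)] {r : ℕ} (hr : 1 < r) {y : C00}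
    (hy : NormSet p r y) (x : Ell p) : pair x y ≤ normingSup p r x := by
  refine le_ciSup (f := fun y : {y // NormSet p r y} => pair x y.1) ?_ ⟨y, hy⟩
  refine ⟨‖x‖, ?_⟩
  rintro _ ⟨y, rfl⟩
  exact pair_le_norm hr y.2 x

theorem normingSup_le_norm {p : ℝ} [Fact (1 < p)] {r : ℕ} (hr : 1 < r) (x : Ell p) :
    normingSup p r x ≤ ‖x‖ := ciSup_le fun y => pair_le_norm hr y.2 x

theorem normingSup_add {p : ℝ} [Fact (1 < p)] {r : ℕ} (hr : 1 < r) (x x' : Ell p) :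
    normingSup p r (x + x' : Ell p) ≤ normingSup p r x + normingSup p r x' := by
  refine ciSup_le fun y => ?_
  rw [lp.coeFn_add, pair_add]
  exact add_le_add (pair_le_normingSup hr y.2 x) (pair_le_normingSup hr y.2 x')

theorem normingSup_smul_le {p : ℝ} [Fact (1 < p)] {r : ℕ} (hr : 1 < r) (c : ℝ) (x : Ell p) :
    normingSup p r (c • x : Ell p) ≤ |c| * normingSup p r x := by
  refine ciSup_le fun y => ?_
  rw [lp.coeFn_smul, pair_smul]
  rcases le_total 0 c with hc | hc
  · rw [abs_of_nonneg hc]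
    exact mul_le_mul_of_nonneg_left (pair_le_normingSup hr y.2 x) hc
  · rw [abs_of_nonpos hc]
    have h := pair_le_normingSup hr y.2.neg x
    have h2 : pair x (-y.1) = - pair x y.1 := by simp [pair, Finsupp.sum_neg_index]
    rw [h2] at h
    nlinarith

theorem toEll_add (p : ℝ) (x y : C00) : toEll p (x + y) = toEll p x + toEll p y := by
  ext i; simp [toEll]; rfl

theorem toEll_smul (p : ℝ) (c : ℝ) (x : C00) : toEll p (c • x) = c • toEll p x := by
  ext i; simp [toEll]

theorem coe_toEll (p : ℝ) (x : C00) : ((toEll p x : Ell p) : ℕ → ℝ) = x := rfl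

/-- The norm constructed from the norming set. -/
def normingSeminorm (p : ℝ) [Fact (1 < p)] {r : ℕ} (hr : 1 < r) : Seminorm ℝ C00 :=
  Seminorm.ofSMulLE (fun x => normingSup p r (toEll p x))
    (by
      refine le_antisymm ?_ ?_
      · have := normingSup_le_norm hr (toEll p 0)
        have h0 : toEll p 0 = 0 := by ext i; simp [toEll]
        rwa [h0, norm_zero, ← h0] at this
      · have := pair_le_normingSup hr (.single 0 0 (by simp)) (toEll p 0)
        simpa [pair] using this)
    (fun x y => by
      rw [toEll_add]; exact normingSup_add hr _ _)
    (fun c x => by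
      rw [toEll_smul]; exact normingSup_smul_le hr _ _)

theorem normingSeminorm_apply (p : ℝ) [Fact (1 < p)] {r : ℕ} (hr : 1 < r) (x : C00) :
    normingSeminorm p hr x = normingSup p r (toEll p x) := rfl

theorem abs_le_normingSeminorm (p : ℝ) [Fact (1 < p)] {r : ℕ} (hr : 1 < r) (x : C00) (i : ℕ) :
    |x i| ≤ normingSeminorm p hr x := by
  rw [normingSeminorm_apply]
  have h (c : ℝ) (hc : |c| ≤ 1) := pair_le_normingSup hr (.single i c hc) (toEll p x)
  have h1 := h 1 (by simp)
  have h2 := h (-1) (by simp)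
  simp only [pair, Finsupp.sum_single_index, mul_zero] at h1 h2
  change x i * _ ≤ _ at h1
  change x i * _ ≤ _ at h2
  exact abs_le'.2 ⟨by linarith, by linarith⟩

theorem isModified_normingSeminorm (p : ℝ) [Fact (1 < p)] {r : ℕ} (hr : 1 < r) :
    IsModifiedTsirelsonNorm p r (normingSeminorm p hr) := by
  have ht := theta_pos (p := p) hr
  refine ⟨fun x hx => ?_, fun x => le_antisymm ?_ (max_le ?_ ?_)⟩
  · ext i
    have := abs_le_normingSeminorm p hr x i
    rw [hx] at this
    simpa using this
  · refine ciSup_le fun y => ?_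
    obtain ⟨y, hy⟩ := y
    cases hy with
    | single n c hc =>
      refine le_max_of_le_left ?_
      have h1 := abs_le_supNorm x n
      have h2 : x n * c ≤ |x n| := by
        calc _ ≤ |x n * c| := le_abs_self _
          _ = |x n| * |c| := abs_mul _ _
          _ ≤ |x n| * 1 := by gcongr
          _ = |x n| := mul_one _
      simpa [pair, coe_toEll] using h2.trans h1
    | step z hz hd =>
      refine le_max_of_le_right ?_
      simp only [pair_step]
      refine mul_le_mul_of_nonneg_left ?_ ht.le
      refine le_trans ?_ (le_ciSup (bddAbove_seminorm (normingSeminorm p hr) r x)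
        ⟨fun i => ((z i).support : Set ℕ), fun i j hij => by
          simpa using hd hij⟩)
      refine Finset.sum_le_sum fun i _ => ?_
      have h := pair_le_normingSup hr (hz i) (toEll p (restr ((z i).support : Set ℕ) x))
      rw [coe_toEll, pair_restr] at h
      have h2 : restr ((z i).support : Set ℕ) (z i) = z i := by
        ext k
        by_cases hk : k ∈ (z i).support
        · rw [restr_apply_mem (by simpa using hk)]
        · rw [restr_apply_not_mem (by simpa using hk)]
          simpa using (Finsupp.notMem_support_iff.1 hk).symm
      rw [h2] at h
      exact h
  · exact ciSup_le fun i => abs_le_normingSeminorm p hr x i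
  · have hne : Nonempty {F : Fin r → Set ℕ // Pairwise fun i j => Disjoint (F i) (F j)} :=
      ⟨⟨fun _ => ∅, fun i j _ => disjoint_bot_left⟩⟩
    rw [mul_comm, ← le_div_iff₀ ht]
    refine ciSup_le fun F => ?_
    rw [le_div_iff₀ ht, mul_comm]
    refine le_of_forall_pos_le_add fun ε hε => ?_
    have hr0 : (0 : ℝ) < r := by exact_mod_cast (by omega : 0 < r)
    have hδ : 0 < ε / (theta p r * r) := by positivity
    have hex (i : Fin r) : ∃ y : {y // NormSet p r y},
        normingSeminorm p hr (restr (F.1 i) x) - ε / (theta p r * r) <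
          pair (restr (F.1 i) x) y.1 :=
      exists_lt_of_lt_ciSup (sub_lt_self _ hδ)
    choose y hy using hex
    have h1 : ∑ i, normingSeminorm p hr (restr (F.1 i) x) ≤
        ∑ i, pair (restr (F.1 i) x) (y i).1 + r * (ε / (theta p r * r)) := by
      calc _ ≤ ∑ i, (pair (restr (F.1 i) x) (y i).1 + ε / (theta p r * r)) :=
            Finset.sum_le_sum fun i _ => by linarith [hy i]
        _ = _ := by simp [Finset.sum_add_distrib]
    have h2 := pair_le_normingSup hr (NormSet.step (fun i => restr (F.1 i) (y i).1)
      (fun i => (y i).2.restr _) (fun i j hij => by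
        refine Finset.disjoint_left.2 fun k hk hk' => ?_
        exact Set.disjoint_left.1 (F.2 hij) (mem_of_mem_support_restr hk)
          (mem_of_mem_support_restr hk'))) (toEll p x)
    rw [pair_step, coe_toEll] at h2
    simp only [← pair_restr] at h2
    have h3 := mul_le_mul_of_nonneg_left h1 ht.le
    have h4 : theta p r * (r * (ε / (theta p r * r))) = ε := by field_simp
    rw [mul_add, h4] at h3
    rw [normingSeminorm_apply, coe_toEll]
    linarith

/-- There is exactly one norm on `c₀₀` that satisfies the implicit equation. -/
theorem existsUnique_isModifiedTsirelsonNorm (p : ℝ) [hp : Fact (1 < p)] {r : ℕ} (hr : 1 < r) :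
    ∃! N : Seminorm ℝ C00, IsModifiedTsirelsonNorm p r N := by
  refine ⟨normingSeminorm p hr, isModified_normingSeminorm p hr, fun N hN => ?_⟩
  ext x
  exact le_antisymm (le_of_isModified hp.out hr hN (isModified_normingSeminorm p hr) _ x rfl)
    (le_of_isModified hp.out hr (isModified_normingSeminorm p hr) hN _ x rfl)

theorem isModifiedTsirelsonNorm_c00Norm (p : ℝ) [Fact (1 < p)] {r : ℕ} (hr : 1 < r) :
    IsModifiedTsirelsonNorm p r (c00Norm p r) :=
  Classical.epsilon_spec (existsUnique_isModifiedTsirelsonNorm p hr).exists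

theorem c00Norm_eq (p : ℝ) [Fact (1 < p)] {r : ℕ} (hr : 1 < r) :
    c00Norm p r = normingSeminorm p hr :=
  (existsUnique_isModifiedTsirelsonNorm p hr).unique (isModifiedTsirelsonNorm_c00Norm p hr)
    (isModified_normingSeminorm p hr)

theorem denseRange_toEll (p : ℝ) [hp : Fact (1 < p)] : DenseRange (toEll p) := by
  intro x
  have h := lp.hasSum_single (p := ENNReal.ofReal p) ENNReal.ofReal_ne_top x
  refine mem_closure_of_tendsto h (Filter.Eventually.of_forall fun s => ?_)
  refine ⟨∑ i ∈ s, Finsupp.single i (x i), ?_⟩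
  ext k
  simp only [toEll, Finsupp.finsetSum_apply, lp.coeFn_sum, Finset.sum_apply]
  refine Finset.sum_congr rfl fun i _ => ?_
  by_cases h : k = i
  · subst h; simp
  · rw [Finsupp.single_eq_of_ne h, lp.single_apply_ne _ _ _ h]

/-- The norm on `c₀₀` has exactly one continuous extension to `ℓ_p`. -/
theorem existsUnique_isExtension (p : ℝ) [Fact (1 < p)] {r : ℕ} (hr : 1 < r) :
    ∃! f : Ell p → ℝ, IsExtension p r f := by
  refine ⟨fun x => normingSup p r x, ⟨?_, fun x => ?_⟩, fun f hf => ?_⟩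
  · refine (LipschitzWith.of_le_add (f := fun x : Ell p => normingSup p r x)
      fun x y => ?_).continuous
    have h := normingSup_add hr (x - y) y
    rw [sub_add_cancel] at h
    have h2 := normingSup_le_norm hr (x - y)
    rw [dist_eq_norm]
    linarith
  · rw [c00Norm_eq p hr, normingSeminorm_apply]
  · refine (denseRange_toEll p).equalizer hf.1 ?_ ?_
    · refine (LipschitzWith.of_le_add (f := fun x : Ell p => normingSup p r x)
        fun x y => ?_).continuous
      have h := normingSup_add hr (x - y) y
      rw [sub_add_cancel] at h
      have h2 := normingSup_le_norm hr (x - y)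
      rw [dist_eq_norm]
      linarith
    · funext x
      rw [Function.comp_apply, Function.comp_apply, hf.2, c00Norm_eq p hr, normingSeminorm_apply]

theorem isExtension_tsirelsonNorm (p : ℝ) [Fact (1 < p)] {r : ℕ} (hr : 1 < r) :
    IsExtension p r (tsirelsonNorm p r) :=
  Classical.epsilon_spec (existsUnique_isExtension p hr).exists

end Facts

end ModifiedTsirelson

end

/-! The norm is a supremum of pairings with a norming set, and that set is described by prefix
codes. Unfolding a functional as an `r`-ary tree, a leaf at depth `d` has value at most `theta ^ d =
(r ^ (-d)) ^ (1/q)`, and the depths satisfy Kraft's inequality `∑ r ^ (-d i) ≤ 1`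
(`NormSet.exists_kraft`). Conversely any signed choice of depths satisfying Kraft's inequality gives
a functional (`normSet_of_kraft`), because the sets in the implicit equation need only be disjoint,
not successive.

Hence the norm of `x` depends only on the masses `|x i| ^ p`. Write `M` for `Nat.clog 2 r`, about
`log₂ r`, and normalize the masses to `T i` with sum `M`. A functional with weights `c i = r ^ (-d
i)` gains, up to normalization, `∑ (c i) ^ (1/q) * (T i) ^ (1/p)`. Only powers of `r` are available
for `c i`, so a coordinate is used efficiently only when `T i` is close to such a power; otherwise
it loses a factor measured by its distance to the power below on the logarithmic scale. If the
logarithms of the masses are equidistributed modulo `log r`, a fraction of about `1 / M` of the mass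
is efficiently usable at any normalization. The norm is then of order `M ^ (-1/p)` times the
`ℓ_p`-norm: the lower bound uses the mass just above powers of `r` (`le_normingSup_toEll`), while in
the upper bound the loss factors decay geometrically with ratio `2 ^ (-1/q)` and sum to `O(q)`
(`normingSup_toEll_le`, `isProfile_upper`).

Equidistribution is forced inside any subspace. A gliding hump gives nearly disjoint normalized
vectors, and compactness makes their mass distributions modulo `log r` almost equal. A block takes,
for each `j < M`, `2 ^ j` of these vectors with coefficient `2 ^ (-j/p)`: every scale carries mass
one, and the common distribution is averaged over the dyadic shifts of one period
(`massSum_block_le`). The resulting bounds are uniform in the scaling, so they pass to all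
combinations of blocks (`massSum_combination_le`), and a small perturbation moves them into the
given subspace (`tsirelsonNorm_of_close`). -/

namespace ModifiedTsirelson

/-! ### Norming functionals and Kraft's inequality -/

section Kraft

/-- Powers of `r`, each at most `r ^ D` and with sum at least `r ^ D`, have a subfamily with sum
exactly `r ^ D`. -/
theorem exists_subset_sum_pow_eq {r : ℕ} (hr : 1 < r) (D : ℕ) (e : ℕ → ℕ) (S : Finset ℕ)
    (he : ∀ i ∈ S, e i ≤ D) (hS : r ^ D ≤ ∑ i ∈ S, r ^ e i) :
    ∃ T ⊆ S, ∑ i ∈ T, r ^ e i = r ^ D := by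
  classical
  obtain ⟨T, hT, hmin⟩ := Finset.exists_min_image
    (S.powerset.filter fun T => r ^ D ≤ ∑ i ∈ T, r ^ e i) Finset.card
    ⟨S, by simp [hS]⟩
  simp only [Finset.mem_filter, Finset.mem_powerset] at hT hmin
  refine ⟨T, hT.1, le_antisymm ?_ hT.2⟩
  have hne : T.Nonempty := by
    rw [Finset.nonempty_iff_ne_empty]
    rintro rfl
    have : 0 < r ^ D := by positivity
    simp at hT
    omega
  obtain ⟨i, hi, hile⟩ := Finset.exists_min_image T e hne
  -- By minimality of `T`, dropping its smallest power falls below `r ^ D`. That power divides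
  -- everything in sight, so the deficit is at least one copy of it and restoring it cannot
  -- overshoot.
  have hlt : ∑ k ∈ T.erase i, r ^ e k < r ^ D := by
    by_contra hge
    have := hmin (T.erase i) ⟨(Finset.erase_subset _ _).trans hT.1, not_lt.1 hge⟩
    have := Finset.card_erase_lt_of_mem hi
    omega
  rw [← Finset.add_sum_erase T _ hi]
  have hd1 : r ^ e i ∣ r ^ D := pow_dvd_pow _ (he i (hT.1 hi))
  have hd2 : r ^ e i ∣ ∑ k ∈ T.erase i, r ^ e k :=
    Finset.dvd_sum fun k hk => pow_dvd_pow _ (hile k (Finset.mem_of_mem_erase hk))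
  obtain ⟨a, ha⟩ := hd1
  obtain ⟨b, hb⟩ := hd2
  rw [ha, hb] at hlt ⊢
  have : b < a := lt_of_mul_lt_mul_left hlt (by positivity)
  nlinarith [Nat.mul_le_mul_left (r ^ e i) this]

/-- Powers of `r`, each at most `r ^ D` and with sum at most `n * r ^ D`, fit into `n` bins of
capacity `r ^ D`. -/
theorem exists_bins {r : ℕ} (hr : 1 < r) (D : ℕ) (e : ℕ → ℕ) (n : ℕ) (S : Finset ℕ)
    (he : ∀ i ∈ S, e i ≤ D) (hS : ∑ i ∈ S, r ^ e i ≤ n * r ^ D) :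
    ∃ f : ℕ → ℕ, (∀ i ∈ S, f i < n) ∧
      ∀ j, ∑ i ∈ S with f i = j, r ^ e i ≤ r ^ D := by
  classical
  induction n generalizing S with
  | zero =>
    have : S = ∅ := by
      by_contra hne
      obtain ⟨i, hi⟩ := Finset.nonempty_iff_ne_empty.2 hne
      have h1 := Finset.single_le_sum (f := fun i => r ^ e i) (fun _ _ => Nat.zero_le _) hi
      have : 0 < r ^ e i := by positivity
      simp only [zero_mul] at hS
      omega
    subst this
    exact ⟨fun _ => 0, by simp, by simp⟩
  | succ n ih =>
    obtain ⟨T, hTS, hT, hrest⟩ : ∃ T ⊆ S, ∑ i ∈ T, r ^ e i ≤ r ^ D ∧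
        ∑ i ∈ S \ T, r ^ e i ≤ n * r ^ D := by
      rcases le_total (∑ i ∈ S, r ^ e i) (r ^ D) with h | h
      · exact ⟨S, subset_rfl, h, by simp⟩
      · obtain ⟨T, hT, hs⟩ := exists_subset_sum_pow_eq hr D e S he h
        refine ⟨T, hT, hs.le, ?_⟩
        have := Finset.sum_sdiff hT (f := fun i => r ^ e i)
        rw [hs] at this
        have h3 : (n + 1) * r ^ D = n * r ^ D + r ^ D := by ring
        omega
    obtain ⟨f, hf, hb⟩ := ih (S \ T) (fun i hi => he i (Finset.sdiff_subset hi)) hrest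
    refine ⟨fun i => if i ∈ T then n else f i, fun i hi => ?_, fun j => ?_⟩
    · dsimp only
      split_ifs with h
      · omega
      · exact (hf i (by simp [hi, h])).trans (by omega)
    · by_cases hj : j = n
      · subst hj
        refine le_trans (Finset.sum_le_sum_of_subset ?_) hT
        intro i hi
        simp only [Finset.mem_filter] at hi
        by_contra h
        rw [if_neg h] at hi
        have := hf i (by simp [hi.1, h])
        omega
      · refine le_trans (Finset.sum_le_sum_of_subset ?_) (hb j)
        intro i hi
        simp only [Finset.mem_filter, Finset.mem_sdiff] at hi ⊢
        by_cases h : i ∈ T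
        · rw [if_pos h] at hi
          omega
        · rw [if_neg h] at hi
          exact ⟨⟨hi.1, h⟩, hi.2⟩

theorem support_sum_single_subset (S : Finset ℕ) (c : ℕ → ℝ) :
    (∑ i ∈ S, Finsupp.single i (c i)).support ⊆ S := by
  classical
  refine Finsupp.support_finsetSum.trans ?_
  intro k hk
  obtain ⟨i, hi, hk⟩ := Finset.mem_biUnion.1 hk
  have := Finsupp.support_single_subset hk
  rw [Finset.mem_singleton] at this
  exact this ▸ hi

/-- Builds the code tree from the root, in integers: `r ^ e i` is the number of leaves at depth `D`
below the leaf `i`. Unless `i` is the root itself, the leaves are packed into `r` subtrees of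
capacity `r ^ (D - 1)` by `exists_bins`. -/
theorem normSet_of_sum_pow_le {p : ℝ} {r : ℕ} (hr : 1 < r) (σ : ℕ → ℝ) (hσ : ∀ i, |σ i| ≤ 1)
    (D : ℕ) (e : ℕ → ℕ) (S : Finset ℕ) (he : ∀ i ∈ S, e i ≤ D)
    (hS : ∑ i ∈ S, r ^ e i ≤ r ^ D) :
    NormSet p r (∑ i ∈ S, Finsupp.single i (σ i * theta p r ^ (D - e i))) := by
  classical
  -- A leaf of full size exhausts the capacity, so it is alone and the functional is a single
  -- coordinate.
  have hone : ∀ (S : Finset ℕ) (D : ℕ), (∃ i ∈ S, e i = D) → ∑ i ∈ S, r ^ e i ≤ r ^ D →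
      NormSet p r (∑ i ∈ S, Finsupp.single i (σ i * theta p r ^ (D - e i))) := by
    rintro S D ⟨i, hi, hiD⟩ hS
    have hSi : S = {i} := by
      refine (Finset.eq_singleton_iff_unique_mem).2 ⟨hi, fun k hk => ?_⟩
      by_contra hki
      have h1 := Finset.sum_le_sum_of_subset (f := fun i => r ^ e i)
        (Finset.insert_subset hk (Finset.singleton_subset_iff.2 hi))
      rw [Finset.sum_pair hki, hiD] at h1
      have : 0 < r ^ e k := by positivity
      omega
    subst hSi
    rw [Finset.sum_singleton, hiD, Nat.sub_self, pow_zero, mul_one]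
    exact .single i _ (hσ i)
  induction D generalizing S with
  | zero =>
    rcases S.eq_empty_or_nonempty with rfl | ⟨i, hi⟩
    · simpa using NormSet.single (p := p) (r := r) 0 0 (by simp)
    · exact hone S 0 ⟨i, hi, by simpa using he i hi⟩ hS
  | succ D ih =>
    by_cases h : ∃ i ∈ S, e i = D + 1
    · exact hone S _ h hS
    · push Not at h
      have he' : ∀ i ∈ S, e i ≤ D := fun i hi => by
        have := he i hi
        have := h i hi
        omega
      obtain ⟨f, hf, hb⟩ := exists_bins hr D e r S he' (by rwa [pow_succ'] at hS)
      have key : ∑ i ∈ S, Finsupp.single i (σ i * theta p r ^ (D + 1 - e i)) =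
          theta p r • ∑ j : Fin r, ∑ i ∈ S with f i = j,
            Finsupp.single i (σ i * theta p r ^ (D - e i)) := by
        rw [← Finset.sum_range (fun j => ∑ i ∈ S with f i = j,
            Finsupp.single i (σ i * theta p r ^ (D - e i))),
          Finset.sum_fiberwise_of_maps_to (fun i hi => Finset.mem_range.2 (hf i hi)),
          Finset.smul_sum]
        refine Finset.sum_congr rfl fun i hi => ?_
        rw [Finsupp.smul_single, smul_eq_mul, Nat.succ_sub (he' i hi), pow_succ]
        congr 1
        ring
      rw [key]
      refine .step _ (fun j => ih _ (fun i hi => he' i (Finset.mem_of_mem_filter i hi)) (hb j))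
        fun j k hjk => ?_
      refine Disjoint.mono (support_sum_single_subset _ _) (support_sum_single_subset _ _) ?_
      refine Finset.disjoint_left.2 fun i hi hi' => hjk ?_
      simp only [Finset.mem_filter] at hi hi'
      exact Fin.ext (hi.2.symm.trans hi'.2)

/-- Kraft's inequality suffices for membership in the norming set. -/
theorem normSet_of_kraft {p : ℝ} {r : ℕ} (hr : 1 < r) (σ : ℕ → ℝ) (hσ : ∀ i, |σ i| ≤ 1)
    (d : ℕ → ℕ) (S : Finset ℕ) (hS : ∑ i ∈ S, ((r : ℝ)⁻¹) ^ d i ≤ 1) :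
    NormSet p r (∑ i ∈ S, Finsupp.single i (σ i * theta p r ^ d i)) := by
  have h0 : (0 : ℝ) < r := by exact_mod_cast (by omega : 0 < r)
  set D := S.sup d
  have hd : ∀ i ∈ S, d i ≤ D := fun i hi => Finset.le_sup hi
  have h := normSet_of_sum_pow_le (p := p) hr σ hσ D (fun i => D - d i) S
    (fun i _ => Nat.sub_le _ _) (by
      have h1 : (∑ i ∈ S, (r : ℝ) ^ (D - d i)) ≤ (r : ℝ) ^ D := by
        calc _ = (r : ℝ) ^ D * ∑ i ∈ S, ((r : ℝ)⁻¹) ^ d i := by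
              rw [Finset.mul_sum]
              refine Finset.sum_congr rfl fun i hi => ?_
              rw [pow_sub₀ _ h0.ne' (hd i hi), inv_pow]
          _ ≤ (r : ℝ) ^ D * 1 := by gcongr
          _ = _ := mul_one _
      exact_mod_cast h1)
  convert h using 1
  refine Finset.sum_congr rfl fun i hi => ?_
  rw [Nat.sub_sub_self (hd i hi)]

/-- Here `d i` is the depth of the coordinate `i` in the construction of `y`: each step adds one to
it and divides the Kraft sum of each of the `r` parts by `r`. -/
theorem NormSet.exists_kraft {p : ℝ} {r : ℕ} (hr : 1 < r) {y : C00} (hy : NormSet p r y) :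
    ∃ d : ℕ → ℕ, (∀ i ∈ y.support, |y i| ≤ theta p r ^ d i) ∧
      ∑ i ∈ y.support, ((r : ℝ)⁻¹) ^ d i ≤ 1 := by
  classical
  have h0 : (0 : ℝ) < r := by exact_mod_cast (by omega : 0 < r)
  have ht := theta_pos (p := p) hr
  induction hy with
  | single n c hc =>
    refine ⟨fun _ => 0, fun i _ => ?_, ?_⟩
    · by_cases h : i = n
      · simpa [h] using hc
      · rw [Finsupp.single_eq_of_ne h]; simp
    · have : (Finsupp.single n c).support.card ≤ 1 :=
        (Finset.card_le_card Finsupp.support_single_subset).trans (by simp)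
      simpa using this
  | step z _ hd ih =>
    choose d hd1 hd2 using ih
    let f : ℕ → ℕ := fun i => if h : ∃ j, i ∈ (z j).support then d h.choose i + 1 else 0
    have hf : ∀ j, ∀ i ∈ (z j).support, f i = d j i + 1 := fun j i hi => by
      have h : ∃ j, i ∈ (z j).support := ⟨j, hi⟩
      have hj : h.choose = j := by
        by_contra hne
        exact Finset.disjoint_left.1 (hd hne) h.choose_spec hi
      simp only [f, dif_pos h, hj]
    have hsub : (theta p r • ∑ i, z i).support ⊆
        Finset.univ.biUnion fun j => (z j).support :=
      Finsupp.support_smul.trans Finsupp.support_finsetSum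
    refine ⟨f, fun i hi => ?_, ?_⟩
    · obtain ⟨j, -, hj⟩ := Finset.mem_biUnion.1 (hsub hi)
      rw [hf j i hj, Finsupp.smul_apply, Finsupp.finsetSum_apply, Finset.sum_eq_single j,
        smul_eq_mul, abs_mul, abs_of_pos ht, pow_succ']
      · exact mul_le_mul_of_nonneg_left (hd1 j i hj) ht.le
      · intro k _ hk
        exact Finsupp.notMem_support_iff.1 fun hik =>
          Finset.disjoint_left.1 (hd hk) hik hj
      · simp
    · refine (Finset.sum_le_sum_of_subset_of_nonneg hsub fun _ _ _ => by positivity).trans ?_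
      rw [Finset.sum_biUnion fun i _ j _ hij => hd hij]
      calc _ = ∑ j, (r : ℝ)⁻¹ * ∑ i ∈ (z j).support, ((r : ℝ)⁻¹) ^ d j i := by
            refine Finset.sum_congr rfl fun j _ => ?_
            rw [Finset.mul_sum]
            refine Finset.sum_congr rfl fun i hi => ?_
            rw [hf j i hi, pow_succ']
        _ ≤ ∑ _j : Fin r, (r : ℝ)⁻¹ * 1 := by
            refine Finset.sum_le_sum fun j _ => ?_
            gcongr
            exact hd2 j
        _ = 1 := by simp [h0.ne']

end Kraft

/-! ### Masses and weighted masses of finitely supported sequences -/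

section Mass

/-- The `p`-th power of the `ℓ_p`-norm of a finitely supported sequence. -/
noncomputable def mass (p : ℝ) (x : C00) : ℝ := x.sum fun _ t => |t| ^ p

/-- The mass of `x`, weighted with a function `h` of the (scaled) masses of its coordinates. -/
noncomputable def massSum (p : ℝ) (h : ℝ → ℝ) (A : ℝ) (x : C00) : ℝ :=
  x.sum fun _ t => |t| ^ p * h (A * |t| ^ p)

theorem sum_finsetSum_of_disjoint {ι : Type*} (s : Finset ι) (f : ι → C00)
    (hf : ∀ k ∈ s, ∀ l ∈ s, k ≠ l → Disjoint (f k).support (f l).support) (g : ℝ → ℝ) :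
    (∑ k ∈ s, f k).sum (fun _ t => g t) = ∑ k ∈ s, (f k).sum fun _ t => g t := by
  classical
  induction s using Finset.induction_on with
  | empty => simp
  | insert a s ha ih =>
    rw [Finset.sum_insert ha, Finset.sum_insert ha, Finsupp.sum_add_index_of_disjoint,
      ih fun k hk l hl => hf k (Finset.mem_insert_of_mem hk) l (Finset.mem_insert_of_mem hl)]
    refine Disjoint.mono_right Finsupp.support_finsetSum ?_
    rw [Finset.disjoint_biUnion_right]
    intro k hk
    exact hf a (Finset.mem_insert_self _ _) k (Finset.mem_insert_of_mem hk)
      (fun h => ha (h ▸ hk))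

theorem mass_sum {ι : Type*} (p : ℝ) (s : Finset ι) (f : ι → C00)
    (hf : ∀ k ∈ s, ∀ l ∈ s, k ≠ l → Disjoint (f k).support (f l).support) :
    mass p (∑ k ∈ s, f k) = ∑ k ∈ s, mass p (f k) :=
  sum_finsetSum_of_disjoint s f hf fun t => |t| ^ p

theorem massSum_sum {ι : Type*} (p : ℝ) (h : ℝ → ℝ) (A : ℝ) (s : Finset ι) (f : ι → C00)
    (hf : ∀ k ∈ s, ∀ l ∈ s, k ≠ l → Disjoint (f k).support (f l).support) :
    massSum p h A (∑ k ∈ s, f k) = ∑ k ∈ s, massSum p h A (f k) :=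
  sum_finsetSum_of_disjoint s f hf fun t => |t| ^ p * h (A * |t| ^ p)

theorem mass_smul {p : ℝ} (hp : p ≠ 0) (a : ℝ) (x : C00) : mass p (a • x) = |a| ^ p * mass p x := by
  unfold mass
  rw [Finsupp.sum_smul_index (by simp [Real.zero_rpow hp]), Finsupp.sum, Finsupp.sum,
    Finset.mul_sum]
  refine Finset.sum_congr rfl fun i _ => ?_
  rw [abs_mul, Real.mul_rpow (abs_nonneg _) (abs_nonneg _)]

theorem massSum_smul {p : ℝ} (hp : p ≠ 0) (h : ℝ → ℝ) (A a : ℝ) (x : C00) :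
    massSum p h A (a • x) = |a| ^ p * massSum p h (A * |a| ^ p) x := by
  unfold massSum
  rw [Finsupp.sum_smul_index (by simp [Real.zero_rpow hp]), Finsupp.sum, Finsupp.sum,
    Finset.mul_sum]
  refine Finset.sum_congr rfl fun i _ => ?_
  rw [abs_mul, Real.mul_rpow (abs_nonneg _) (abs_nonneg _)]
  ring_nf

theorem mass_nonneg (p : ℝ) (x : C00) : 0 ≤ mass p x :=
  Finset.sum_nonneg fun _ _ => by positivity

theorem norm_toEll_rpow {p : ℝ} (hp : 0 < p) (x : C00) : ‖toEll p x‖ ^ p = mass p x := by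
  have hto : (ENNReal.ofReal p).toReal = p := ENNReal.toReal_ofReal hp.le
  have h := lp.norm_rpow_eq_tsum (p := ENNReal.ofReal p) (by rwa [hto]) (toEll p x)
  rw [hto] at h
  rw [h, tsum_eq_sum (s := x.support)]
  · rfl
  · intro i hi
    rw [coe_toEll, Finsupp.notMem_support_iff.1 hi, norm_zero, Real.zero_rpow hp.ne']

theorem norm_toEll_eq {p : ℝ} [hp : Fact (1 < p)] (x : C00) :
    ‖toEll p x‖ = mass p x ^ (1 / p) := by
  have hp0 : 0 < p := zero_lt_one.trans hp.out
  rw [← norm_toEll_rpow hp0, one_div, Real.rpow_rpow_inv (norm_nonneg _) hp0.ne']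

end Mass

/-! ### Bounds for the norm in terms of weighted masses -/

section Estimates

theorem theta_pow {p : ℝ} {r : ℕ} (hr : 1 < r) (d : ℕ) :
    theta p r ^ d = (((r : ℝ)⁻¹) ^ d) ^ (1 / p.conjExponent) := by
  have h0 : (0 : ℝ) < r := by exact_mod_cast (by omega : 0 < r)
  unfold theta
  rw [one_div ((r : ℝ) ^ _), ← Real.inv_rpow h0.le, ← Real.rpow_natCast, ← Real.rpow_mul
    (by positivity), mul_comm, Real.rpow_mul (by positivity), Real.rpow_natCast]

/-- The weight that bounds the contribution of a coordinate of mass `T` to a norming functional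
whose value there is small. -/
noncomputable def upperWeight (q : ℝ) (r : ℕ) (T : ℝ) : ℝ := ((r : ℝ) ^ Int.log r (T / 2) / T) ^ (1 / q)

/-- Minus the indicator function of the numbers in `⋃ k, [r ^ k, 4 * r ^ k)`. -/
noncomputable def lowerWeight (r : ℕ) (T : ℝ) : ℝ := by
  classical exact if ∃ k : ℤ, (r : ℝ) ^ k ≤ T ∧ T < 4 * (r : ℝ) ^ k then -1 else 0

/-- Two cases for `c = r ^ (-d)`. If `T ≤ 2 * c`, the left side is at most `2 * c`, which Kraft's
inequality will sum. Otherwise `c` is a power of `r` below `T / 2`, hence at most the largest such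
power, and the left side equals `T * (c / T) ^ (1 / q)`. -/
theorem rpow_mul_rpow_le_upperWeight {p q : ℝ} (hpq : p.HolderConjugate q) {r : ℕ} (hr : 1 < r)
    (d : ℕ) {T : ℝ} (hT : 0 ≤ T) :
    (((r : ℝ)⁻¹) ^ d) ^ (1 / q) * T ^ (1 / p) ≤
      2 * ((r : ℝ)⁻¹) ^ d + T * upperWeight q r T := by
  have h0 : (0 : ℝ) < r := by exact_mod_cast (by omega : 0 < r)
  have hp := hpq.pos
  have hq := hpq.symm.pos
  have hadd : 1 / p + 1 / q = 1 := by simpa using hpq.inv_add_inv_eq_one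
  set c : ℝ := ((r : ℝ)⁻¹) ^ d with hc
  have hc0 : 0 < c := by positivity
  have hU : 0 ≤ T * upperWeight q r T := by unfold upperWeight; positivity
  rcases le_or_gt T (2 * c) with h | h
  · calc c ^ (1 / q) * T ^ (1 / p) ≤ (2 * c) ^ (1 / q) * (2 * c) ^ (1 / p) := by
          gcongr
          linarith
      _ = 2 * c := by
          rw [← Real.rpow_add (by positivity), add_comm, hadd, Real.rpow_one]
      _ ≤ _ := by linarith
  · have hT0 : 0 < T := by linarith
    have hcz : c = (r : ℝ) ^ (-(d : ℤ)) := by rw [hc, zpow_neg, zpow_natCast, inv_pow]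
    have h1 : -(d : ℤ) ≤ Int.log r (T / 2) := by
      rw [← Int.zpow_le_iff_le_log hr (by positivity), ← hcz]
      linarith
    have h2 : c ≤ (r : ℝ) ^ Int.log r (T / 2) := by
      rw [hcz]
      exact zpow_le_zpow_right₀ (by exact_mod_cast hr.le) h1
    calc c ^ (1 / q) * T ^ (1 / p) = T * (c / T) ^ (1 / q) := by
          rw [Real.div_rpow hc0.le hT]
          have : T = T ^ (1 / p) * T ^ (1 / q) := by
            rw [← Real.rpow_add hT0, hadd, Real.rpow_one]
          have h3 : T ^ (1 / q) ≠ 0 := by positivity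
          field_simp
          rw [← this]
      _ ≤ T * upperWeight q r T := by
          unfold upperWeight
          gcongr
      _ ≤ _ := by linarith

/-- Recovers a coordinate from its normalized mass `M / P * |t| ^ p`; when `P` is the total mass,
these add up to `M`. -/
theorem rpow_inv_mul_eq {p P M t : ℝ} (hp : 0 < p) (hP : 0 < P) (hM : 0 < M) :
    (M⁻¹ ^ (1 / p) * P ^ (1 / p)) * (M / P * |t| ^ p) ^ (1 / p) = |t| := by
  have h3 : (|t| ^ p) ^ (1 / p) = |t| := by
    rw [one_div, Real.rpow_rpow_inv (abs_nonneg _) hp.ne']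
  rw [← Real.mul_rpow (by positivity) (by positivity),
    ← Real.mul_rpow (by positivity) (by positivity)]
  have : M⁻¹ * P * (M / P * |t| ^ p) = |t| ^ p := by field_simp
  rw [this, h3]

/-- Against any functional, the coordinates with large weight contribute at most `2` by Kraft's
inequality, and the rest at most `C` by the hypothesis at `A = M / mass p x`. -/
theorem normingSup_toEll_le {p : ℝ} [hp : Fact (1 < p)] {r : ℕ} (hr : 1 < r) {M C : ℝ} (hM : 0 < M)
    (x : C00) (hx : ∀ A > 0, massSum p (upperWeight p.conjExponent r) A x ≤ C / M * mass p x) :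
    normingSup p r (toEll p x) ≤ (2 + C) * M⁻¹ ^ (1 / p) * ‖toEll p x‖ := by
  classical
  have hp0 : 0 < p := zero_lt_one.trans hp.out
  have hpq := Real.HolderConjugate.conjExponent hp.out
  rcases (mass_nonneg p x).eq_or_lt with hP | hP
  · have h := normingSup_le_norm hr (toEll p x)
    have h2 : ‖toEll p x‖ = 0 := by
      rw [norm_toEll_eq, ← hP, Real.zero_rpow (by positivity)]
    rw [h2] at h ⊢
    simpa using h
  rw [norm_toEll_eq]
  set P := mass p x with hPdef
  set T : ℕ → ℝ := fun i => M / P * |x i| ^ p with hTdef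
  have hT0 : ∀ i, 0 ≤ T i := fun i => by positivity
  refine ciSup_le fun y => ?_
  obtain ⟨y, hy⟩ := y
  obtain ⟨d, hd, hd1⟩ := hy.exists_kraft hr
  have hterm : ∀ i ∈ y.support, x i * y i ≤ (M⁻¹ ^ (1 / p) * P ^ (1 / p)) *
      (2 * ((r : ℝ)⁻¹) ^ d i + T i * upperWeight p.conjExponent r (T i)) := fun i hi => by
    calc x i * y i ≤ |x i| * |y i| := by rw [← abs_mul]; exact le_abs_self _
      _ ≤ |x i| * theta p r ^ d i := by gcongr; exact hd i hi
      _ = (M⁻¹ ^ (1 / p) * P ^ (1 / p)) *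
          ((((r : ℝ)⁻¹) ^ d i) ^ (1 / p.conjExponent) * T i ^ (1 / p)) := by
          rw [← theta_pow hr]
          conv_lhs => rw [← rpow_inv_mul_eq (t := x i) hp0 hP hM]
          ring
      _ ≤ _ := by
          gcongr
          exact rpow_mul_rpow_le_upperWeight hpq hr _ (hT0 i)
  have hU : ∀ i, 0 ≤ T i * upperWeight p.conjExponent r (T i) := fun i => by
    have := hT0 i
    unfold upperWeight
    positivity
  have hsum : ∑ i ∈ y.support, T i * upperWeight p.conjExponent r (T i) ≤ C := by
    calc _ ≤ ∑ i ∈ x.support, T i * upperWeight p.conjExponent r (T i) := by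
          rw [Finset.sum_subset (Finset.subset_union_right (s₁ := y.support) (s₂ := x.support)) fun i _ hi => by
            simp [hTdef, Finsupp.notMem_support_iff.1 hi, Real.zero_rpow hp0.ne']]
          exact Finset.sum_le_sum_of_subset_of_nonneg Finset.subset_union_left fun i _ _ => hU i
      _ = M / P * massSum p (upperWeight p.conjExponent r) (M / P) x := by
          rw [massSum, Finsupp.sum, Finset.mul_sum]
          exact Finset.sum_congr rfl fun i _ => by simp only [hTdef]; ring
      _ ≤ M / P * (C / M * P) := by
          gcongr
          exact hx _ (by positivity)
      _ = C := by field_simp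
  rw [coe_toEll, pair_eq _ y _ subset_rfl]
  refine (Finset.sum_le_sum hterm).trans ?_
  rw [← Finset.mul_sum, Finset.sum_add_distrib, ← Finset.mul_sum]
  calc _ ≤ (M⁻¹ ^ (1 / p) * P ^ (1 / p)) * (2 * 1 + C) := by gcongr
    _ = _ := by ring

/-- Discard terms while the sum exceeds `1`. If one removal jumps below `1 / 8`, the removed term
alone exceeds `7 / 8` and serves as the subfamily. -/
theorem exists_subset_sum_mem {ι : Type*} (S : Finset ι) (c : ι → ℝ) (h0 : ∀ i ∈ S, 0 ≤ c i)
    (h1 : ∀ i ∈ S, c i ≤ 1) (hS : 1 / 8 ≤ ∑ i ∈ S, c i) :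
    ∃ T ⊆ S, 1 / 8 ≤ ∑ i ∈ T, c i ∧ ∑ i ∈ T, c i ≤ 1 := by
  classical
  induction S using Finset.induction_on with
  | empty => norm_num at hS
  | insert a s ha ih =>
    rcases le_or_gt (∑ i ∈ insert a s, c i) 1 with h | h
    · exact ⟨_, subset_rfl, hS, h⟩
    rcases le_or_gt (1 / 8) (∑ i ∈ s, c i) with h' | h'
    · obtain ⟨T, hT, h2⟩ := ih (fun i hi => h0 i (Finset.mem_insert_of_mem hi))
        (fun i hi => h1 i (Finset.mem_insert_of_mem hi)) h'
      exact ⟨T, hT.trans (Finset.subset_insert _ _), h2⟩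
    · refine ⟨{a}, by simp, ?_, ?_⟩
      · rw [Finset.sum_insert ha] at h
        rw [Finset.sum_singleton]
        linarith
      · simpa using h1 a (Finset.mem_insert_self _ _)

/-- Give each coordinate whose normalized mass lies in some `[r ^ k, 4 * r ^ k)` the depth `-k`. The
hypothesis says that these coordinates carry normalized mass at least `1 / 2`, so part of them
satisfies Kraft's inequality with a sum bounded below. -/
theorem le_normingSup_toEll {p : ℝ} [hp : Fact (1 < p)] {r : ℕ} (hr : 1 < r) {M : ℝ} (hM : 0 < M)
    (hMr : M < r) (x : C00)
    (hx : ∀ A > 0, massSum p (lowerWeight r) A x ≤ -(1 / 2) / M * mass p x) :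
    1 / 8 * M⁻¹ ^ (1 / p) * ‖toEll p x‖ ≤ normingSup p r (toEll p x) := by
  classical
  have h0 : (0 : ℝ) < r := by exact_mod_cast (by omega : 0 < r)
  have h1r : (1 : ℝ) < r := by exact_mod_cast hr
  have hp0 : 0 < p := zero_lt_one.trans hp.out
  have hpq := Real.HolderConjugate.conjExponent hp.out
  have hq0 := hpq.symm.pos
  have hadd : 1 / p + 1 / p.conjExponent = 1 := by simpa using hpq.inv_add_inv_eq_one
  rcases (mass_nonneg p x).eq_or_lt with hP | hP
  · have h := pair_le_normingSup hr (.single 0 0 (by simp)) (toEll p x)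
    have h2 : ‖toEll p x‖ = 0 := by
      rw [norm_toEll_eq, ← hP, Real.zero_rpow (by positivity)]
    rw [h2]
    simpa [pair] using h
  rw [norm_toEll_eq]
  set P := mass p x with hPdef
  set T : ℕ → ℝ := fun i => M / P * |x i| ^ p with hTdef
  have hTr : ∀ i ∈ x.support, T i < r := fun i hi => by
    have : |x i| ^ p ≤ P :=
      Finset.single_le_sum (f := fun i => |x i| ^ p) (fun _ _ => by positivity) hi
    calc T i ≤ M / P * P := by simp only [hTdef]; gcongr
      _ = M := by field_simp
      _ < r := hMr
  set B := x.support.filter fun i => ∃ k : ℤ, (r : ℝ) ^ k ≤ T i ∧ T i < 4 * (r : ℝ) ^ k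
  have hex : ∀ i, ∃ d : ℕ, i ∈ B → ((r : ℝ)⁻¹) ^ d ≤ T i ∧ T i < 4 * ((r : ℝ)⁻¹) ^ d := by
    intro i
    by_cases hi : i ∈ B
    · obtain ⟨his, k, hk1, hk2⟩ := Finset.mem_filter.1 hi
      -- Normalized masses are at most `M < r`, so `k ≤ 0` and the depth `-k` is a natural number.
      have hk : k < 1 := by
        have := hk1.trans_lt (hTr i his)
        rw [← zpow_one (r : ℝ), ← zpow_mul, one_mul] at this
        exact (zpow_lt_zpow_iff_right₀ h1r).1 this
      obtain ⟨d, hd⟩ := Int.eq_ofNat_of_zero_le (show 0 ≤ -k by omega)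
      have hkd : (r : ℝ) ^ k = ((r : ℝ)⁻¹) ^ d := by
        rw [show k = -(d : ℤ) by omega, zpow_neg, zpow_natCast, inv_pow]
      exact ⟨d, fun _ => by rw [← hkd]; exact ⟨hk1, hk2⟩⟩
    · exact ⟨0, fun h => absurd h hi⟩
  choose d hd using hex
  have hBsum : 1 / 2 ≤ ∑ i ∈ B, T i := by
    have h2 : massSum p (lowerWeight r) (M / P) x = -∑ i ∈ B, |x i| ^ p := by
      rw [massSum, Finsupp.sum, Finset.sum_filter, ← Finset.sum_neg_distrib]
      refine Finset.sum_congr rfl fun i _ => ?_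
      unfold lowerWeight
      simp only [hTdef]
      split_ifs <;> simp
    have h3 := hx (M / P) (by positivity)
    rw [h2] at h3
    simp only [hTdef]
    rw [← Finset.mul_sum]
    calc (1 : ℝ) / 2 = M / P * ((1 / 2) / M * P) := by field_simp
      _ ≤ _ := by
        gcongr
        linarith [show -(1 / 2) / M * P = -((1 / 2) / M * P) by ring]
  -- The width `4` of the windows costs a factor `4` in the mass `1 / 2`.
  have hc : 1 / 8 ≤ ∑ i ∈ B, ((r : ℝ)⁻¹) ^ d i := by
    have : ∑ i ∈ B, T i ≤ ∑ i ∈ B, 4 * ((r : ℝ)⁻¹) ^ d i :=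
      Finset.sum_le_sum fun i hi => (hd i hi).2.le
    rw [← Finset.mul_sum B _ (4 : ℝ)] at this
    linarith
  obtain ⟨S, hSB, hS8, hS1⟩ := exists_subset_sum_mem B _ (fun i _ => by positivity)
    (fun i _ => pow_le_one₀ (by positivity) (inv_le_one_of_one_le₀ h1r.le)) hc
  let σ : ℕ → ℝ := fun i => if 0 ≤ x i then 1 else -1
  have hσ : ∀ i, |σ i| ≤ 1 := fun i => by simp only [σ]; split_ifs <;> simp
  have hσx : ∀ i, x i * σ i = |x i| := fun i => by
    simp only [σ]
    split_ifs with h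
    · rw [abs_of_nonneg h, mul_one]
    · rw [abs_of_neg (not_le.1 h)]; ring
  refine le_trans ?_ (pair_le_normingSup hr (normSet_of_kraft hr σ hσ d S hS1) (toEll p x))
  rw [coe_toEll, pair_eq _ _ S (support_sum_single_subset _ _)]
  calc 1 / 8 * M⁻¹ ^ (1 / p) * P ^ (1 / p)
      = (M⁻¹ ^ (1 / p) * P ^ (1 / p)) * (1 / 8) := by ring
    _ ≤ (M⁻¹ ^ (1 / p) * P ^ (1 / p)) * ∑ i ∈ S, ((r : ℝ)⁻¹) ^ d i := by gcongr
    _ = ∑ i ∈ S, (M⁻¹ ^ (1 / p) * P ^ (1 / p)) * ((r : ℝ)⁻¹) ^ d i := Finset.mul_sum _ _ _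
    _ ≤ _ := Finset.sum_le_sum fun i hi => ?_
  have hval : (∑ k ∈ S, Finsupp.single k (σ k * theta p r ^ d k)) i = σ i * theta p r ^ d i := by
    rw [Finsupp.finsetSum_apply, Finset.sum_eq_single i]
    · simp
    · intro k _ hk
      exact Finsupp.single_eq_of_ne hk.symm
    · exact fun h => absurd hi h
  rw [hval, ← mul_assoc, hσx, theta_pow hr]
  conv_rhs => rw [← rpow_inv_mul_eq (t := x i) hp0 hP hM]
  rw [mul_assoc _ (_ ^ (1 / p)) ((_ : ℝ) ^ (1 / p.conjExponent))]
  refine mul_le_mul_of_nonneg_left ?_ (by positivity)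
  set c : ℝ := ((r : ℝ)⁻¹) ^ d i
  have hc0 : 0 < c := by positivity
  calc c = c ^ (1 / p) * c ^ (1 / p.conjExponent) := by
        rw [← Real.rpow_add hc0, hadd, Real.rpow_one]
    _ ≤ _ := by
        gcongr
        exact (hd i (hSB hi)).1

end Estimates

/-! ### Sums of the weights over one period of dyadic scales -/

section Profiles

/-- `H` is a `log r`-periodic bounded function that dominates `h` up to a factor of two in the
argument, and whose sums over `M` consecutive dyadic scales are at most `C`. -/
structure IsProfile (r M : ℕ) (h H : ℝ → ℝ) (C : ℝ) : Prop where
  periodic : ∀ (d : ℤ) (T : ℝ), 0 < T → H ((r : ℝ) ^ d * T) = H T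
  abs_le_one : ∀ T, 0 < T → |H T| ≤ 1
  le_of_mem : ∀ T₀ T, 0 < T₀ → T₀ ≤ T → T < 2 * T₀ → h T ≤ H T₀
  sum_le : ∀ A, 0 < A → ∑ j ∈ Finset.range M, H (A / 2 ^ j) ≤ C

theorem exists_dyadic_level {r : ℕ} (hr : 1 < r) {A : ℝ} (hA : 0 < A) :
    ∃ (d : ℤ) (m : ℕ), m < Nat.clog 2 r ∧ (r : ℝ) ^ d * 2 ^ m ≤ A ∧ A < (r : ℝ) ^ d * 2 ^ (m + 1) ∧
      A < (r : ℝ) ^ (d + 1) := by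
  have h0 : (0 : ℝ) < r := by exact_mod_cast (by omega : 0 < r)
  have h1 := Int.zpow_log_le_self hr hA
  have h2 := Int.lt_zpow_succ_log_self hr A
  set d := Int.log r A
  have hd : (0 : ℝ) < (r : ℝ) ^ d := by positivity
  obtain ⟨m, hm1, hm2⟩ := exists_nat_pow_near (x := A / (r : ℝ) ^ d) (y := 2)
    (by rwa [one_le_div hd]) one_lt_two
  rw [le_div_iff₀ hd, mul_comm] at hm1
  rw [div_lt_iff₀ hd, mul_comm] at hm2
  refine ⟨d, m, ?_, hm1, hm2, h2⟩
  have h3 : (r : ℝ) ^ d * 2 ^ m < (r : ℝ) ^ d * r := by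
    rw [← zpow_add_one₀ h0.ne']
    exact hm1.trans_lt h2
  have h4 : (2 : ℝ) ^ m < r := lt_of_mul_lt_mul_left h3 hd.le
  have h5 : 2 ^ m < 2 ^ Nat.clog 2 r :=
    (by exact_mod_cast h4 : 2 ^ m < r).trans_le (Nat.le_pow_clog one_lt_two r)
  exact (Nat.pow_lt_pow_iff_right one_lt_two).1 h5

theorem log_zpow_mul {r : ℕ} (hr : 1 < r) (d : ℤ) {T : ℝ} (hT : 0 < T) :
    Int.log r ((r : ℝ) ^ d * T) = d + Int.log r T := by
  have h0 : (0 : ℝ) < r := by exact_mod_cast (by omega : 0 < r)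
  have hd : (0 : ℝ) < (r : ℝ) ^ d := by positivity
  refine eq_of_forall_le_iff fun z => ?_
  rw [← Int.zpow_le_iff_le_log hr (by positivity), ← sub_le_iff_le_add',
    ← Int.zpow_le_iff_le_log hr hT, zpow_sub₀ h0.ne', div_le_iff₀' hd]

/-- The profile of `upperWeight`. -/
noncomputable def upperProfile (q : ℝ) (r : ℕ) (T : ℝ) : ℝ := ((r : ℝ) ^ Int.log r T / T) ^ (1 / q)

/-- The profile of `lowerWeight`. -/
noncomputable def lowerProfile (r : ℕ) (T : ℝ) : ℝ := by
  classical exact if ∃ k : ℤ, (r : ℝ) ^ k ≤ T ∧ T < 2 * (r : ℝ) ^ k then -1 else 0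

/-- A mass `k` dyadic steps above the last power of `r` loses a factor `2 ^ (-k/q)`. -/
theorem upperProfile_le {q : ℝ} (hq : 0 < q) {r : ℕ} (hr : 1 < r) {T : ℝ} (d : ℤ) (k : ℕ)
    (h1 : (r : ℝ) ^ d * 2 ^ k ≤ T) (h2 : T < (r : ℝ) ^ (d + 1)) :
    upperProfile q r T ≤ ((1 / 2 : ℝ) ^ (1 / q)) ^ k := by
  have h0 : (0 : ℝ) < r := by exact_mod_cast (by omega : 0 < r)
  have hd : (0 : ℝ) < (r : ℝ) ^ d := by positivity
  have hT : 0 < T := lt_of_lt_of_le (by positivity) h1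
  have hlog : Int.log r T ≤ d := by
    have h3 := (Int.zpow_log_le_self hr hT).trans_lt h2
    have := (zpow_lt_zpow_iff_right₀ (by exact_mod_cast hr)).1 h3
    omega
  have h3 : (r : ℝ) ^ Int.log r T / T ≤ (1 / 2) ^ k := by
    rw [div_le_iff₀ hT]
    calc (r : ℝ) ^ Int.log r T ≤ (r : ℝ) ^ d := zpow_le_zpow_right₀ (by exact_mod_cast hr.le) hlog
      _ = (1 / 2) ^ k * ((r : ℝ) ^ d * 2 ^ k) := by
          rw [mul_comm, mul_assoc, ← mul_pow]; norm_num
      _ ≤ _ := by gcongr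
  rw [← Real.rpow_natCast, ← Real.rpow_mul (by positivity), mul_comm, Real.rpow_mul (by positivity),
    Real.rpow_natCast]
  unfold upperProfile
  gcongr

theorem geom_sum_half_rpow_le {q : ℝ} (hq : 1 < q) (n : ℕ) :
    ∑ k ∈ Finset.range n, ((1 / 2 : ℝ) ^ (1 / q)) ^ k ≤ 2 * q := by
  have hq0 : 0 < q := by linarith
  set x : ℝ := (1 / 2) ^ (1 / q)
  have hx0 : 0 < x := by positivity
  have hx : x ≤ 1 - 1 / (2 * q) := by
    -- Bernoulli's inequality for the exponent `1 / q ≤ 1` keeps the ratio away from `1` by `1 / (2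
    -- * q)`; this is where the factor `q` in the final constant comes from.
    have h := rpow_one_add_le_one_add_mul_self (s := -(1 / 2)) (by norm_num) (p := 1 / q)
      (by positivity) (by rw [div_le_one hq0]; exact hq.le)
    calc x = (1 + -(1 / 2)) ^ (1 / q) := by norm_num [x]
      _ ≤ _ := h
      _ = _ := by field_simp; ring
  have hpos : (0 : ℝ) < 1 / (2 * q) := by positivity
  have hgeom : (∑ k ∈ Finset.range n, x ^ k) * (1 - x) ≤ 1 := by
    have := geom_sum_mul x n
    have hxn : 0 ≤ x ^ n := by positivity
    nlinarith
  have hs : 0 ≤ ∑ k ∈ Finset.range n, x ^ k := Finset.sum_nonneg fun _ _ => by positivity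
  have : (∑ k ∈ Finset.range n, x ^ k) * (1 / (2 * q)) ≤ 1 :=
    (mul_le_mul_of_nonneg_left (by linarith) hs).trans hgeom
  rw [mul_one_div, div_le_one (by positivity)] at this
  exact this

theorem isProfile_upper {q : ℝ} (hq : 1 < q) {r : ℕ} (hr : 1 < r) :
    IsProfile r (Nat.clog 2 r) (upperWeight q r) (upperProfile q r) (4 * q) where
  periodic d T hT := by
    have h0 : (0 : ℝ) < r := by exact_mod_cast (by omega : 0 < r)
    unfold upperProfile
    rw [log_zpow_mul hr d hT, zpow_add₀ h0.ne', mul_div_mul_left _ _ (by positivity)]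
  abs_le_one T hT := by
    have h0 : (0 : ℝ) < r := by exact_mod_cast (by omega : 0 < r)
    unfold upperProfile
    rw [abs_of_nonneg (by positivity)]
    refine Real.rpow_le_one (by positivity) ?_ (by positivity)
    rw [div_le_one hT]
    exact Int.zpow_log_le_self hr hT
  le_of_mem T₀ T h₀ h1 h2 := by
    have h0 : (0 : ℝ) < r := by exact_mod_cast (by omega : 0 < r)
    unfold upperWeight upperProfile
    have : Int.log r (T / 2) ≤ Int.log r T₀ :=
      Int.log_mono_right (by linarith) (by linarith)
    have hr1 : (1 : ℝ) ≤ r := by exact_mod_cast hr.le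
    have hT : 0 < T := h₀.trans_le h1
    refine Real.rpow_le_rpow (by positivity) ?_ (by positivity)
    exact div_le_div₀ (by positivity) (zpow_le_zpow_right₀ hr1 this) h₀ h1
  sum_le A hA := by
    have h0 : (0 : ℝ) < r := by exact_mod_cast (by omega : 0 < r)
    obtain ⟨d, m, hm, h1, h2, h3⟩ := exists_dyadic_level hr hA
    have hd : (0 : ℝ) < (r : ℝ) ^ d := by positivity
    set M := Nat.clog 2 r with hMdef
    set x : ℝ := (1 / 2) ^ (1 / q)
    have hx0 : 0 < x := by positivity
    -- Halving `A` repeatedly crosses `r ^ d` once, after step `m`. Up to there the exponents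
    -- descend to `0`; afterwards the scales are compared with `r ^ (d - 1)`, and `2 ^ (M - 1) < r`
    -- keeps them above it. This gives two geometric sums of at most `2 * q` each.
    have hterm : ∀ j ∈ Finset.range M, upperProfile q r (A / 2 ^ j) ≤
        (if j ∈ Finset.range (m + 1) then x ^ (m + 1 - 1 - j) else 0) + x ^ (M - 1 - j) := by
      intro j hj
      rw [Finset.mem_range] at hj
      have hj2 : (0 : ℝ) < 2 ^ j := by positivity
      split_ifs with hjm
      · rw [Finset.mem_range] at hjm
        refine le_add_of_le_of_nonneg (upperProfile_le (by linarith) hr d _ ?_ ?_) (by positivity)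
        · rw [le_div_iff₀ hj2, mul_assoc, ← pow_add]
          rwa [show m + 1 - 1 - j + j = m by omega]
        · refine (div_le_self hA.le (one_le_pow₀ one_le_two)).trans_lt h3
      · rw [Finset.mem_range] at hjm
        rw [zero_add]
        refine upperProfile_le (by linarith) hr (d - 1) _ ?_ ?_
        · rw [le_div_iff₀ hj2, mul_assoc, ← pow_add, show M - 1 - j + j = M - 1 by omega]
          have hlt : (2 : ℝ) ^ (M - 1) ≤ r := by
            exact_mod_cast (Nat.pow_pred_clog_lt_self one_lt_two hr).le
          calc (r : ℝ) ^ (d - 1) * 2 ^ (M - 1) ≤ (r : ℝ) ^ (d - 1) * r := by gcongr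
            _ = (r : ℝ) ^ d * 1 := by rw [← zpow_add_one₀ h0.ne']; simp
            _ ≤ (r : ℝ) ^ d * 2 ^ m := by gcongr; exact one_le_pow₀ one_le_two
            _ ≤ A := h1
        · rw [div_lt_iff₀ hj2, sub_add_cancel]
          refine h2.trans_le ?_
          gcongr
          · exact one_le_two
          · omega
    refine (Finset.sum_le_sum hterm).trans ?_
    rw [Finset.sum_add_distrib, Finset.sum_range_reflect (fun k => x ^ k) M, Finset.sum_ite_mem,
      Finset.inter_eq_right.2 (Finset.range_mono (by omega)),
      Finset.sum_range_reflect (fun k => x ^ k) (m + 1)]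
    linarith [geom_sum_half_rpow_le hq M, geom_sum_half_rpow_le hq (m + 1)]

theorem isProfile_lower {r : ℕ} (hr : 1 < r) :
    IsProfile r (Nat.clog 2 r) (lowerWeight r) (lowerProfile r) (-1) where
  periodic d T hT := by
    have h0 : (0 : ℝ) < r := by exact_mod_cast (by omega : 0 < r)
    have hd : (0 : ℝ) < (r : ℝ) ^ d := by positivity
    unfold lowerProfile
    congr 1
    refine propext ⟨fun ⟨k, h1, h2⟩ => ⟨k - d, ?_, ?_⟩, fun ⟨k, h1, h2⟩ => ⟨d + k, ?_, ?_⟩⟩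
    · rwa [zpow_sub₀ h0.ne', div_le_iff₀' hd]
    · rwa [zpow_sub₀ h0.ne', ← mul_div_assoc, lt_div_iff₀' hd]
    · rw [zpow_add₀ h0.ne']
      gcongr
    · rw [zpow_add₀ h0.ne', mul_left_comm]
      gcongr
  abs_le_one T _ := by
    unfold lowerProfile
    split_ifs <;> simp
  le_of_mem T₀ T h₀ h1 h2 := by
    unfold lowerWeight lowerProfile
    by_cases h : ∃ k : ℤ, (r : ℝ) ^ k ≤ T₀ ∧ T₀ < 2 * (r : ℝ) ^ k
    · obtain ⟨k, hk1, hk2⟩ := h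
      rw [if_pos ⟨k, by linarith, by linarith⟩]
      split_ifs <;> norm_num
    · rw [if_neg h]
      split_ifs <;> norm_num
  sum_le A hA := by
    obtain ⟨d, m, hm, h1, h2, -⟩ := exists_dyadic_level hr hA
    have h2m : (0 : ℝ) < 2 ^ m := by positivity
    have hneg : ∀ T, lowerProfile r T ≤ 0 := fun T => by
      unfold lowerProfile
      split_ifs <;> norm_num
    rw [← Finset.add_sum_erase _ _ (Finset.mem_range.2 hm)]
    -- Among `M` consecutive halvings, the `m`-th lands in the dyadic interval just above `r ^ d`.
    have hm1 : lowerProfile r (A / 2 ^ m) = -1 := by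
      unfold lowerProfile
      refine if_pos ⟨d, ?_, ?_⟩
      · rwa [le_div_iff₀ h2m]
      · rw [div_lt_iff₀ h2m]
        exact h2.trans_eq (by ring)
    rw [hm1]
    linarith [Finset.sum_nonpos fun j (_ : j ∈ (Finset.range (Nat.clog 2 r)).erase m) =>
      hneg (A / 2 ^ j)]

end Profiles

/-! ### Blocks that equidistribute masses over the dyadic scales -/

section Blocks

/-- The dyadic position of `t > 0` between two consecutive powers of `r`. -/
noncomputable def bucket (r : ℕ) (t : ℝ) : ℕ := by
  classical exact
    if h : 1 < r ∧ 0 < t then (exists_dyadic_level h.1 h.2).choose_spec.choose else 0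

theorem bucket_spec {r : ℕ} (hr : 1 < r) {t : ℝ} (ht : 0 < t) :
    bucket r t < Nat.clog 2 r ∧ ∃ d : ℤ, (r : ℝ) ^ d * 2 ^ bucket r t ≤ t ∧
      t < 2 * ((r : ℝ) ^ d * 2 ^ bucket r t) := by
  have h := (exists_dyadic_level hr ht).choose_spec.choose_spec
  unfold bucket
  rw [dif_pos ⟨hr, ht⟩]
  exact ⟨h.1, _, h.2.1, h.2.2.1.trans_eq (by ring)⟩

/-- The mass of the coordinates of `u` in bucket `b`. -/
noncomputable def bucketMass (p : ℝ) (r : ℕ) (u : C00) (b : ℕ) : ℝ :=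
  ∑ i ∈ u.support with bucket r (|u i| ^ p) = b, |u i| ^ p

theorem bucketMass_nonneg (p : ℝ) (r : ℕ) (u : C00) (b : ℕ) : 0 ≤ bucketMass p r u b :=
  Finset.sum_nonneg fun _ _ => by positivity

theorem abs_rpow_pos_of_mem_support (p : ℝ) {u : C00} {i : ℕ} (hi : i ∈ u.support) :
    0 < |u i| ^ p :=
  Real.rpow_pos_of_pos (abs_pos.2 (Finsupp.mem_support_iff.1 hi)) _

theorem bucket_mem_range (p : ℝ) {r : ℕ} (hr : 1 < r) {u : C00} {i : ℕ} (hi : i ∈ u.support) :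
    bucket r (|u i| ^ p) ∈ Finset.range (Nat.clog 2 r) :=
  Finset.mem_range.2 (bucket_spec hr (abs_rpow_pos_of_mem_support p hi)).1

theorem sum_bucketMass (p : ℝ) {r : ℕ} (hr : 1 < r) (u : C00) :
    ∑ b ∈ Finset.range (Nat.clog 2 r), bucketMass p r u b = mass p u :=
  Finset.sum_fiberwise_of_maps_to (fun _ hi => bucket_mem_range p hr hi) _

/-- A mass in bucket `b` is `r ^ d * 2 ^ b` up to a factor below two. Domination by the profile
absorbs that factor, and periodicity removes `r ^ d`. -/
theorem massSum_le_sum_bucketMass (p : ℝ) {r : ℕ} (hr : 1 < r) {h H : ℝ → ℝ} {C : ℝ}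
    (hH : IsProfile r (Nat.clog 2 r) h H C) {A : ℝ} (hA : 0 < A) (u : C00) :
    massSum p h A u ≤
      ∑ b ∈ Finset.range (Nat.clog 2 r), bucketMass p r u b * H (A * 2 ^ b) := by
  have h0 : (0 : ℝ) < r := by exact_mod_cast (by omega : 0 < r)
  rw [massSum, Finsupp.sum,
    ← Finset.sum_fiberwise_of_maps_to (fun _ hi => bucket_mem_range p hr hi)]
  refine Finset.sum_le_sum fun b _ => ?_
  rw [bucketMass, Finset.sum_mul]
  refine Finset.sum_le_sum fun i hi => ?_
  obtain ⟨hi, hb⟩ := Finset.mem_filter.1 hi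
  obtain ⟨-, d, h1, h2⟩ := bucket_spec hr (abs_rpow_pos_of_mem_support p hi)
  rw [hb] at h1 h2
  refine mul_le_mul_of_nonneg_left ?_ (by positivity)
  rw [← hH.periodic d _ (by positivity)]
  refine hH.le_of_mem _ _ (by positivity) ?_ ?_
  · rw [mul_left_comm]
    gcongr
  · rw [mul_left_comm _ A, mul_left_comm 2 A]
    gcongr

/-- The indices of the vectors that make up a block: `2 ^ j` vectors of scale `j` for `j < M`. -/
def blockIndices (M : ℕ) : Finset (Σ _ : ℕ, ℕ) :=
  (Finset.range M).sigma fun j => Finset.range (2 ^ j)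

/-- The position in a sequence of the vector with index `a` of the `n`-th block. -/
def blockPos (n : ℕ) (a : Σ _ : ℕ, ℕ) : ℕ := Nat.pair n (Nat.pair a.1 a.2)

theorem blockPos_inj {n m : ℕ} {a b : Σ _ : ℕ, ℕ} (h : blockPos n a = blockPos m b) :
    n = m ∧ a = b := by
  obtain ⟨h1, h2⟩ := Nat.pair_eq_pair.1 h
  obtain ⟨h2, h3⟩ := Nat.pair_eq_pair.1 h2
  refine ⟨h1, ?_⟩
  rcases a with ⟨a, a'⟩
  rcases b with ⟨b, b'⟩
  simp_all

/-- The coefficient of the vectors of scale `j` in a block. -/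
noncomputable def blockCoeff (p : ℝ) (j : ℕ) : ℝ := ((2 : ℝ) ^ j)⁻¹ ^ (1 / p)

/-- The `n`-th block of the sequence `u`. -/
noncomputable def block {E : Type*} [AddCommGroup E] [Module ℝ E] (p : ℝ) (M : ℕ) (u : ℕ → E)
    (n : ℕ) : E :=
  ∑ a ∈ blockIndices M, blockCoeff p a.1 • u (blockPos n a)

theorem blockCoeff_rpow {p : ℝ} (hp : 0 < p) (j : ℕ) : |blockCoeff p j| ^ p = ((2 : ℝ) ^ j)⁻¹ := by
  unfold blockCoeff
  rw [abs_of_nonneg (by positivity), one_div, Real.rpow_inv_rpow (by positivity) hp.ne']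

theorem abs_blockCoeff_le_one {p : ℝ} (hp : 0 < p) (j : ℕ) : |blockCoeff p j| ≤ 1 := by
  unfold blockCoeff
  rw [abs_of_nonneg (by positivity)]
  exact Real.rpow_le_one (by positivity)
    (inv_le_one_of_one_le₀ (one_le_pow₀ one_le_two)) (by positivity)

theorem sum_blockIndices (M : ℕ) (f : ℕ → ℝ) :
    ∑ a ∈ blockIndices M, ((2 : ℝ) ^ a.1)⁻¹ * f a.1 = ∑ j ∈ Finset.range M, f j := by
  rw [blockIndices, Finset.sum_sigma]
  refine Finset.sum_congr rfl fun j _ => ?_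
  simp

theorem exists_mem_support_of_mem_support_block {p : ℝ} {M : ℕ} {u : ℕ → C00} {n i : ℕ}
    (hi : i ∈ (block p M u n).support) : ∃ a, i ∈ (u (blockPos n a)).support := by
  classical
  obtain ⟨a, -, ha⟩ := Finset.mem_biUnion.1 (Finsupp.support_finsetSum hi)
  exact ⟨a, Finsupp.support_smul ha⟩

variable {p : ℝ} {r : ℕ} {u : ℕ → C00}

theorem disjoint_support_block (M : ℕ)
    (hu : Pairwise fun k l => Disjoint (u k).support (u l).support) {n m : ℕ} (hnm : n ≠ m) :
    Disjoint (block p M u n).support (block p M u m).support := by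
  refine Finset.disjoint_left.2 fun i hi hi' => ?_
  obtain ⟨a, ha⟩ := exists_mem_support_of_mem_support_block hi
  obtain ⟨b, hb⟩ := exists_mem_support_of_mem_support_block hi'
  exact Finset.disjoint_left.1 (hu fun h => hnm (blockPos_inj h).1) ha hb

theorem disjoint_support_smul (hu : Pairwise fun k l => Disjoint (u k).support (u l).support)
    (c c' : ℝ) {k l : ℕ} (hkl : k ≠ l) :
    Disjoint (c • u k).support (c' • u l).support :=
  (hu hkl).mono Finsupp.support_smul Finsupp.support_smul

/-- Each of the `M` scales has `2 ^ j` vectors of mass `2 ^ (-j)`. -/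
theorem mass_block (hp : 0 < p) (M : ℕ)
    (hu : Pairwise fun k l => Disjoint (u k).support (u l).support) (h1 : ∀ k, mass p (u k) = 1)
    (n : ℕ) : mass p (block p M u n) = M := by
  rw [block, mass_sum _ _ _ fun a _ b _ hab =>
    disjoint_support_smul hu _ _ fun h => hab (blockPos_inj h).2]
  simp_rw [mass_smul hp.ne', blockCoeff_rpow hp, h1]
  rw [sum_blockIndices M fun _ => 1]
  simp

/-- As all vectors have almost the same bucket masses, the sum over scales can be taken inside for
each bucket, where the profile sums to at most `C` over a full set of shifts. The bound does not
grow with `M`, although the block has mass `M`. -/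
theorem massSum_block_le (hp : 0 < p) (hr : 1 < r) {h H : ℝ → ℝ} {C : ℝ}
    (hH : IsProfile r (Nat.clog 2 r) h H C)
    (hu : Pairwise fun k l => Disjoint (u k).support (u l).support) (h1 : ∀ k, mass p (u k) = 1)
    (hprof : ∀ k, ∀ b < Nat.clog 2 r, |bucketMass p r (u k) b - bucketMass p r (u 0) b| ≤
      1 / (2 * (Nat.clog 2 r : ℝ) ^ 2)) (n : ℕ) {A : ℝ} (hA : 0 < A) :
    massSum p h A (block p (Nat.clog 2 r) u n) ≤ C + 1 / 2 := by
  have hMpos : 0 < Nat.clog 2 r := Nat.clog_pos one_lt_two hr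
  set M := Nat.clog 2 r with hM
  have hM0 : (0 : ℝ) < M := by exact_mod_cast hMpos
  rw [block, massSum_sum _ _ _ _ _ fun a _ b _ hab =>
    disjoint_support_smul hu _ _ fun h => hab (blockPos_inj h).2]
  simp_rw [massSum_smul hp.ne', blockCoeff_rpow hp]
  set π := bucketMass p r (u 0)
  calc _ ≤ ∑ a ∈ blockIndices M, ((2 : ℝ) ^ a.1)⁻¹ *
        ∑ b ∈ Finset.range M, (π b * H (A * 2 ^ b / 2 ^ a.1) + 1 / (2 * (M : ℝ) ^ 2)) := by
        refine Finset.sum_le_sum fun a _ => mul_le_mul_of_nonneg_left ?_ (by positivity)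
        refine (massSum_le_sum_bucketMass p hr hH (by positivity) _).trans ?_
        refine Finset.sum_le_sum fun b hb => ?_
        have e1 : A * (2 ^ a.1)⁻¹ * 2 ^ b = A * 2 ^ b / 2 ^ a.1 := by ring
        rw [e1]
        have h2 := hH.abs_le_one (A * 2 ^ b / 2 ^ a.1) (by positivity)
        have h3 := hprof (blockPos n a) b (Finset.mem_range.1 hb)
        have h4 : (bucketMass p r (u (blockPos n a)) b - π b) * H (A * 2 ^ b / 2 ^ a.1) ≤
            1 / (2 * (M : ℝ) ^ 2) * 1 := by
          refine (le_abs_self _).trans ?_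
          rw [abs_mul]
          gcongr
        linarith
    -- The errors `1 / (2 * M ^ 2)` occur once for each of the `M` buckets at each of the `M`
    -- scales.
    _ = ∑ b ∈ Finset.range M, π b * ∑ j ∈ Finset.range M, H (A * 2 ^ b / 2 ^ j) + 1 / 2 := by
        rw [sum_blockIndices M fun j =>
          ∑ b ∈ Finset.range M, (π b * H (A * 2 ^ b / 2 ^ j) + 1 / (2 * (M : ℝ) ^ 2)),
          Finset.sum_comm]
        simp_rw [Finset.sum_add_distrib, Finset.mul_sum]
        congr 1
        simp
        field_simp
    _ ≤ ∑ b ∈ Finset.range M, π b * C + 1 / 2 := by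
        gcongr with b
        · exact bucketMass_nonneg _ _ _ _
        · exact hH.sum_le _ (by positivity)
    _ = C + 1 / 2 := by
        rw [← Finset.sum_mul, sum_bucketMass p hr, h1, one_mul]

theorem mass_combination (hp : 0 < p) (M : ℕ)
    (hu : Pairwise fun k l => Disjoint (u k).support (u l).support) (h1 : ∀ k, mass p (u k) = 1)
    (a : ℕ →₀ ℝ) :
    mass p (a.sum fun n c => c • block p M u n) = ∑ n ∈ a.support, |a n| ^ p * M := by
  rw [Finsupp.sum, mass_sum _ _ _ fun n _ m _ hnm =>
    (disjoint_support_block M hu hnm).mono Finsupp.support_smul Finsupp.support_smul]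
  simp_rw [mass_smul hp.ne', mass_block hp M hu h1]

/-- A coefficient only changes the scaling `A` of its block, and the bound for a block holds for all
`A`. -/
theorem massSum_combination_le (hp : 0 < p) (hr : 1 < r) {h H : ℝ → ℝ} {C : ℝ}
    (hH : IsProfile r (Nat.clog 2 r) h H C)
    (hu : Pairwise fun k l => Disjoint (u k).support (u l).support) (h1 : ∀ k, mass p (u k) = 1)
    (hprof : ∀ k, ∀ b < Nat.clog 2 r, |bucketMass p r (u k) b - bucketMass p r (u 0) b| ≤
      1 / (2 * (Nat.clog 2 r : ℝ) ^ 2)) (a : ℕ →₀ ℝ) {A : ℝ} (hA : 0 < A) :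
    massSum p h A (a.sum fun n c => c • block p (Nat.clog 2 r) u n) ≤
      (C + 1 / 2) / (Nat.clog 2 r : ℝ) *
        mass p (a.sum fun n c => c • block p (Nat.clog 2 r) u n) := by
  have hM0 : (0 : ℝ) < (Nat.clog 2 r : ℝ) := by exact_mod_cast Nat.clog_pos one_lt_two hr
  rw [mass_combination hp _ hu h1, Finsupp.sum, massSum_sum _ _ _ _ _ fun n _ m _ hnm =>
    (disjoint_support_block _ hu hnm).mono Finsupp.support_smul Finsupp.support_smul,
    Finset.mul_sum]
  refine Finset.sum_le_sum fun n hn => ?_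
  have hpos := abs_rpow_pos_of_mem_support p hn
  rw [massSum_smul hp.ne']
  calc _ ≤ |a n| ^ p * (C + 1 / 2) := by
        gcongr
        exact massSum_block_le hp hr hH hu h1 hprof n (by positivity)
    _ = _ := by field_simp

end Blocks

/-! ### Almost disjoint sequences in a subspace -/

section GlidingHump

/-- The inclusion of `c₀₀` in `ℓ_p` as a linear map. -/
noncomputable def toEllLinear (p : ℝ) : C00 →ₗ[ℝ] Ell p where
  toFun := toEll p
  map_add' := toEll_add p
  map_smul' := toEll_smul p

theorem toEllLinear_apply (p : ℝ) (x : C00) : toEllLinear p x = toEll p x := rfl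

/-- The projection to the first `m` coordinates cannot be injective on an infinite-dimensional
space. -/
theorem exists_mem_ne_zero_of_not_finiteDimensional {p : ℝ} {X : Submodule ℝ (Ell p)}
    (hX : ¬ FiniteDimensional ℝ X) (m : ℕ) : ∃ x ∈ X, x ≠ 0 ∧ ∀ i < m, x i = 0 := by
  let f : X →ₗ[ℝ] (Fin m → ℝ) :=
    { toFun := fun x i => (x : Ell p) i
      map_add' := fun x y => by ext i; simp
      map_smul' := fun c x => by ext i; simp }
  by_contra! hne
  refine hX (FiniteDimensional.of_injective f ?_)
  rw [← LinearMap.ker_eq_bot, LinearMap.ker_eq_bot']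
  intro x hx
  by_contra h0
  obtain ⟨i, him, hi⟩ := hne x x.2 (by simpa using h0)
  exact hi (congrFun hx ⟨i, him⟩)

variable {p : ℝ} [hp : Fact (1 < p)]

theorem tsirelsonNorm_eq {r : ℕ} (hr : 1 < r) (x : Ell p) :
    tsirelsonNorm p r x = normingSup p r x := by
  have hext : IsExtension p r fun x : Ell p => normingSup p r x := by
    refine ⟨(LipschitzWith.of_le_add fun x y => ?_).continuous, fun x => ?_⟩
    · have h := normingSup_add hr (x - y) y
      rw [sub_add_cancel] at h
      have h2 := normingSup_le_norm hr (x - y)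
      rw [dist_eq_norm]
      linarith
    · rw [c00Norm_eq p hr, normingSeminorm_apply]
  exact congrFun ((existsUnique_isExtension p hr).unique (isExtension_tsirelsonNorm p hr) hext) x

theorem tsirelsonNorm_add_le {r : ℕ} (hr : 1 < r) (x y : Ell p) :
    tsirelsonNorm p r (x + y) ≤ tsirelsonNorm p r x + tsirelsonNorm p r y := by
  simp only [tsirelsonNorm_eq hr]
  exact normingSup_add hr x y

theorem tsirelsonNorm_le_norm {r : ℕ} (hr : 1 < r) (x : Ell p) : tsirelsonNorm p r x ≤ ‖x‖ := by
  rw [tsirelsonNorm_eq hr]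
  exact normingSup_le_norm hr x

theorem exists_approx_toEll {X : Submodule ℝ (Ell p)} (hX : ¬ FiniteDimensional ℝ X) (m : ℕ)
    {ε : ℝ} (hε : 0 < ε) :
    ∃ x ∈ X, ∃ u : C00, mass p u = 1 ∧ (∀ i < m, u i = 0) ∧ ‖x - toEll p u‖ ≤ ε := by
  have hp0 : 0 < p := zero_lt_one.trans hp.out
  obtain ⟨x₀, hx₀, hne, hx₀m⟩ := exists_mem_ne_zero_of_not_finiteDimensional hX m
  have hn : 0 < ‖x₀‖ := norm_pos_iff.2 hne
  have h := lp.hasSum_single (p := ENNReal.ofReal p) ENNReal.ofReal_ne_top x₀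
  -- The bound `1 / 2` keeps the truncation at no less than half the norm of `x₀`, so that
  -- normalizing it at most doubles the relative error `ε / 2`.
  have hη : 0 < min (1 / 2) (ε / 2) * ‖x₀‖ := by positivity
  obtain ⟨s, hs⟩ := ((Metric.tendsto_nhds.1 h) _ hη).exists
  have hs' : ∑ i ∈ s, lp.single (ENNReal.ofReal p) i (x₀ i) =
      toEll p (∑ i ∈ s, Finsupp.single i (x₀ i)) := by
    ext k
    simp only [toEll, Finsupp.finsetSum_apply, lp.coeFn_sum, Finset.sum_apply]
    refine Finset.sum_congr rfl fun i _ => ?_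
    by_cases h : k = i
    · subst h; simp
    · rw [Finsupp.single_eq_of_ne h, lp.single_apply_ne _ _ _ h]
  rw [hs', dist_eq_norm, norm_sub_rev] at hs
  set u₀ : C00 := ∑ i ∈ s, Finsupp.single i (x₀ i)
  have h1 : ‖x₀ - toEll p u₀‖ ≤ 1 / 2 * ‖x₀‖ := hs.le.trans (by gcongr; exact min_le_left _ _)
  have h2 : ‖x₀ - toEll p u₀‖ ≤ ε / 2 * ‖x₀‖ := hs.le.trans (by gcongr; exact min_le_right _ _)
  have h3 : ‖x₀‖ ≤ ‖toEll p u₀‖ + ‖x₀ - toEll p u₀‖ := by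
    simpa [add_comm] using norm_add_le (x₀ - toEll p u₀) (toEll p u₀)
  have hu : 0 < ‖toEll p u₀‖ := by linarith
  refine ⟨‖toEll p u₀‖⁻¹ • x₀, X.smul_mem _ hx₀, ‖toEll p u₀‖⁻¹ • u₀, ?_, ?_, ?_⟩
  · rw [← norm_toEll_rpow hp0, toEll_smul, norm_smul, norm_inv, norm_norm, inv_mul_cancel₀ hu.ne',
      Real.one_rpow]
  · intro i hi
    rw [Finsupp.smul_apply, Finsupp.finsetSum_apply, Finset.sum_eq_zero, smul_zero]
    intro k _
    by_cases hk : i = k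
    · rw [← hk, hx₀m i hi]; simp
    · exact Finsupp.single_eq_of_ne hk
  · rw [toEll_smul, ← smul_sub, norm_smul, norm_inv, norm_norm, inv_mul_le_iff₀ hu]
    nlinarith

/-- Every infinite-dimensional subspace of `ℓ_p` contains vectors arbitrarily close to a normalized
disjointly supported sequence. -/
theorem exists_seq_approx_disjoint {X : Submodule ℝ (Ell p)} (hX : ¬ FiniteDimensional ℝ X)
    (ε : ℕ → ℝ) (hε : ∀ k, 0 < ε k) :
    ∃ (x : ℕ → Ell p) (u : ℕ → C00), (∀ k, x k ∈ X) ∧ (∀ k, mass p (u k) = 1) ∧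
      (Pairwise fun k l => Disjoint (u k).support (u l).support) ∧
      ∀ k, ‖x k - toEll p (u k)‖ ≤ ε k := by
  choose x hx u hu hum hxu using fun m k => exists_approx_toEll hX m (hε k)
  -- The hump `k` starts at `m k`, beyond the supports of all earlier humps.
  let m : ℕ → ℕ := fun k => Nat.rec 0 (fun k m => max m ((u m k).support.sup id + 1)) k
  have hm1 : ∀ k, m k ≤ m (k + 1) := fun k => le_max_left _ _
  have hm2 : ∀ k, ∀ i ∈ (u (m k) k).support, i < m (k + 1) := fun k i hi =>
    lt_of_lt_of_le (Nat.lt_succ_of_le (Finset.le_sup (f := id) hi)) (le_max_right _ _)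
  have hmono : Monotone m := monotone_nat_of_le_succ hm1
  refine ⟨fun k => x (m k) k, fun k => u (m k) k, fun k => hx _ _, fun k => hu _ _, ?_,
    fun k => hxu _ _⟩
  have hlt : ∀ k l, k < l → Disjoint (u (m k) k).support (u (m l) l).support := fun k l hkl => by
    refine Finset.disjoint_left.2 fun i hi hi' => ?_
    exact Finsupp.mem_support_iff.1 hi' (hum _ _ i ((hm2 k i hi).trans_le (hmono hkl)))
  intro k l hkl
  rcases lt_or_gt_of_ne hkl with h | h
  · exact hlt k l h
  · exact (hlt l k h).symm

/-- Bucket masses of normalized vectors lie in a compact cube, so a subsequence is Cauchy; starting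
it late enough makes its first term the reference. -/
theorem exists_subseq_bucketMass_close {p : ℝ} {r : ℕ} (hr : 1 < r) (u : ℕ → C00)
    (hu : ∀ k, mass p (u k) = 1) {η : ℝ} (hη : 0 < η) :
    ∃ φ : ℕ → ℕ, StrictMono φ ∧ ∀ k, ∀ b < Nat.clog 2 r,
      |bucketMass p r (u (φ k)) b - bucketMass p r (u (φ 0)) b| ≤ η := by
  have hmem : ∀ k, (fun b : Fin (Nat.clog 2 r) => bucketMass p r (u k) b) ∈
      Set.Icc (0 : Fin (Nat.clog 2 r) → ℝ) 1 := fun k =>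
    ⟨fun b => bucketMass_nonneg _ _ _ _, fun b => by
      rw [Pi.one_apply, ← hu k, ← sum_bucketMass p hr]
      exact Finset.single_le_sum (f := bucketMass p r (u k)) (fun _ _ => bucketMass_nonneg _ _ _ _)
        (Finset.mem_range.2 b.2)⟩
  obtain ⟨π, -, φ, hφ, hlim⟩ := tendsto_subseq_of_bounded (Metric.isBounded_Icc _ _) hmem
  obtain ⟨N, hN⟩ := Metric.cauchySeq_iff'.1 hlim.cauchySeq η hη
  refine ⟨fun k => φ (N + k), fun k l hkl => hφ (by omega), fun k b hb => ?_⟩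
  have h := (dist_le_pi_dist _ _ ⟨b, hb⟩).trans (hN (N + k) (by omega)).le
  rwa [Real.dist_eq] at h

end GlidingHump

/-! ### Perturbation of combinations of blocks -/

section Combination

variable {p : ℝ} [hp : Fact (1 < p)] {x : ℕ → Ell p} {u : ℕ → C00} {ε : ℕ → ℝ} {δ : ℝ}

theorem toEll_block {p : ℝ} (M : ℕ) (u : ℕ → C00) (n : ℕ) :
    toEll p (block p M u n) = block p M (fun k => toEll p (u k)) n := by
  rw [← toEllLinear_apply, block, map_sum]
  simp_rw [map_smul]
  rfl

theorem norm_block_sub_le (M : ℕ) (hxu : ∀ k, ‖x k - toEll p (u k)‖ ≤ ε k) (n : ℕ) :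
    ‖block p M x n - toEll p (block p M u n)‖ ≤ ∑ a ∈ blockIndices M, ε (blockPos n a) := by
  have hp0 : 0 < p := zero_lt_one.trans hp.out
  rw [toEll_block, block, block, ← Finset.sum_sub_distrib]
  refine (norm_sum_le _ _).trans (Finset.sum_le_sum fun a _ => ?_)
  rw [← smul_sub, norm_smul]
  calc _ ≤ 1 * ε (blockPos n a) :=
        mul_le_mul (abs_blockCoeff_le_one hp0 _) (hxu _) (norm_nonneg _) zero_le_one
    _ = _ := one_mul _

theorem sum_blockPos_le (M : ℕ) (hδ : ∀ s : Finset ℕ, ∑ k ∈ s, ε k ≤ δ)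
    (s : Finset ℕ) : ∑ n ∈ s, ∑ a ∈ blockIndices M, ε (blockPos n a) ≤ δ := by
  classical
  rw [← Finset.sum_product' s (blockIndices M) fun n a => ε (blockPos n a)]
  rw [← Finset.sum_image (s := s ×ˢ blockIndices M) (g := fun z => blockPos z.1 z.2) (f := ε)]
  · exact hδ _
  · intro z _ w _ h
    obtain ⟨h1, h2⟩ := blockPos_inj h
    exact Prod.ext h1 h2

/-- Blocks are disjoint and each has mass `M ≥ 1`, so coefficients are dominated by the norm of the
combination. Summable errors in the vectors thus give a relative error in every combination. -/
theorem abs_le_norm_combination {M : ℕ} (hM : 0 < M)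
    (hu : Pairwise fun k l => Disjoint (u k).support (u l).support) (h1 : ∀ k, mass p (u k) = 1)
    (a : ℕ →₀ ℝ) (n : ℕ) : |a n| ≤ ‖toEll p (a.sum fun n c => c • block p M u n)‖ := by
  have hp0 : 0 < p := zero_lt_one.trans hp.out
  have hM1 : (1 : ℝ) ≤ M := by exact_mod_cast hM
  by_cases hn : n ∈ a.support
  · rw [← Real.rpow_le_rpow_iff (abs_nonneg _) (norm_nonneg _) hp0, norm_toEll_rpow hp0,
      mass_combination hp0 M hu h1]
    calc |a n| ^ p ≤ |a n| ^ p * M := le_mul_of_one_le_right (by positivity) hM1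
      _ ≤ _ := Finset.single_le_sum (f := fun n => |a n| ^ p * (M : ℝ))
        (fun _ _ => by positivity) hn
  · rw [Finsupp.notMem_support_iff.1 hn, abs_zero]
    exact norm_nonneg _

theorem norm_combination_sub_le {M : ℕ} (hM : 0 < M)
    (hu : Pairwise fun k l => Disjoint (u k).support (u l).support) (h1 : ∀ k, mass p (u k) = 1)
    (hxu : ∀ k, ‖x k - toEll p (u k)‖ ≤ ε k) (hδ : ∀ s : Finset ℕ, ∑ k ∈ s, ε k ≤ δ)
    (a : ℕ →₀ ℝ) :
    ‖(a.sum fun n c => c • block p M x n) - toEll p (a.sum fun n c => c • block p M u n)‖ ≤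
      δ * ‖toEll p (a.sum fun n c => c • block p M u n)‖ := by
  have habs := abs_le_norm_combination hM hu h1 a
  set v := a.sum fun n c => c • block p M u n with hv
  have hv' : toEll p v = a.sum fun n c => c • toEll p (block p M u n) := by
    rw [← toEllLinear_apply, hv, Finsupp.sum, map_sum]
    simp_rw [map_smul]
    rfl
  conv_lhs => rw [hv']
  rw [Finsupp.sum, Finsupp.sum, ← Finset.sum_sub_distrib]
  calc _ ≤ ∑ n ∈ a.support, ‖toEll p v‖ * ∑ i ∈ blockIndices M, ε (blockPos n i) := by
        refine (norm_sum_le _ _).trans (Finset.sum_le_sum fun n _ => ?_)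
        rw [← smul_sub, norm_smul]
        exact mul_le_mul (habs n) (norm_block_sub_le M hxu n) (norm_nonneg _) (norm_nonneg _)
    _ ≤ _ := by
        rw [← Finset.mul_sum, mul_comm]
        gcongr
        exact sum_blockPos_le M hδ _

/-- A vanishing combination would give its disjoint model `v` a norm with `‖v‖ ≤ δ * ‖v‖`; since `δ
< 1`, `v` and all coefficients vanish. -/
theorem linearIndependent_block {M : ℕ} (hM : 0 < M)
    (hu : Pairwise fun k l => Disjoint (u k).support (u l).support) (h1 : ∀ k, mass p (u k) = 1)
    (hxu : ∀ k, ‖x k - toEll p (u k)‖ ≤ ε k) (hδ : ∀ s : Finset ℕ, ∑ k ∈ s, ε k ≤ δ)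
    (hδ1 : δ < 1) : LinearIndependent ℝ (block p M x) := by
  rw [linearIndependent_iff]
  intro a ha
  rw [Finsupp.linearCombination_apply] at ha
  have h := norm_combination_sub_le hM hu h1 hxu hδ a
  rw [ha, zero_sub, norm_neg] at h
  have h0 : ‖toEll p (a.sum fun n c => c • block p M u n)‖ = 0 :=
    le_antisymm (by nlinarith [norm_nonneg (toEll p (a.sum fun n c => c • block p M u n))])
      (norm_nonneg _)
  ext n
  have := abs_le_norm_combination hM hu h1 a n
  rw [h0] at this
  simpa using this

end Combination

/-! ### The equivalence on a subspace -/

section Main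

variable {p : ℝ} [hp : Fact (1 < p)] {r : ℕ} {u : ℕ → C00}

theorem one_le_logb (hr : 1 < r) : 1 ≤ Real.logb 2 r := by
  rw [Real.le_logb_iff_rpow_le one_lt_two (by exact_mod_cast (by omega : 0 < r)), Real.rpow_one]
  exact_mod_cast hr

theorem logb_le_clog (hr : 1 < r) : Real.logb 2 r ≤ Nat.clog 2 r := by
  rw [Real.logb_le_iff_le_rpow one_lt_two (by exact_mod_cast (by omega : 0 < r)),
    Real.rpow_natCast]
  exact_mod_cast Nat.le_pow_clog one_lt_two r

theorem clog_le_two_mul_logb (hr : 1 < r) : (Nat.clog 2 r : ℝ) ≤ 2 * Real.logb 2 r := by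
  have hM : 0 < Nat.clog 2 r := Nat.clog_pos one_lt_two hr
  have h : ((Nat.clog 2 r - 1 : ℕ) : ℝ) ≤ Real.logb 2 r := by
    rw [Real.le_logb_iff_rpow_le one_lt_two (by exact_mod_cast (by omega : 0 < r)),
      Real.rpow_natCast]
    exact_mod_cast (Nat.pow_pred_clog_lt_self one_lt_two hr).le
  rw [Nat.cast_sub hM, Nat.cast_one] at h
  linarith [one_le_logb hr]

/-- With `M = Nat.clog 2 r`, `M ≤ 2 ^ (M - 1) < r`. The lower estimate needs it to keep normalized
masses below `r`. -/
theorem clog_lt (hr : 1 < r) : Nat.clog 2 r < r := by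
  have h := Nat.pow_pred_clog_lt_self one_lt_two hr
  have h2 : Nat.clog 2 r - 1 < 2 ^ (Nat.clog 2 r - 1) := Nat.lt_two_pow_self
  simp only [Nat.pred_eq_sub_one] at h
  omega

/-- Rounding `log₂ r` up costs at most a factor two, and the exponent `1 / p ≤ 1` does not worsen
it. -/
theorem logb_rpow_mul_inv_clog_rpow {p : ℝ} (hp1 : 1 < p) (hr : 1 < r) :
    1 / 2 ≤ Real.logb 2 r ^ (1 / p) * (Nat.clog 2 r : ℝ)⁻¹ ^ (1 / p) ∧
      Real.logb 2 r ^ (1 / p) * (Nat.clog 2 r : ℝ)⁻¹ ^ (1 / p) ≤ 1 := by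
  have hp0 : 0 < p := by linarith
  have hL := one_le_logb hr
  have hLM := logb_le_clog hr
  have hML := clog_le_two_mul_logb hr
  have hM : (0 : ℝ) < Nat.clog 2 r := by linarith
  rw [← Real.mul_rpow (by linarith) (by positivity), ← div_eq_mul_inv]
  have h1 : Real.logb 2 r / Nat.clog 2 r ≤ 1 := (div_le_one hM).2 hLM
  have h2 : 1 / 2 ≤ Real.logb 2 r / Nat.clog 2 r := by
    rw [le_div_iff₀ hM]
    linarith
  have hpinv : 1 / p ≤ 1 := by rw [div_le_one hp0]; exact hp1.le
  refine ⟨h2.trans ?_, Real.rpow_le_one (by linarith) h1 (by positivity)⟩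
  simpa using Real.rpow_le_rpow_of_exponent_ge (by linarith) h1 hpinv

/-- On combinations of blocks the norm is equivalent to the `ℓ_p`-norm, up to a power of `log r`. -/
theorem tsirelsonNorm_combination (hr : 1 < r)
    (hu : Pairwise fun k l => Disjoint (u k).support (u l).support) (h1 : ∀ k, mass p (u k) = 1)
    (hprof : ∀ k, ∀ b < Nat.clog 2 r, |bucketMass p r (u k) b - bucketMass p r (u 0) b| ≤
      1 / (2 * (Nat.clog 2 r : ℝ) ^ 2)) (a : ℕ →₀ ℝ) :
    let v := toEll p (a.sum fun n c => c • block p (Nat.clog 2 r) u n)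
    1 / 16 * ‖v‖ ≤ Real.logb 2 r ^ (1 / p) * tsirelsonNorm p r v ∧
      Real.logb 2 r ^ (1 / p) * tsirelsonNorm p r v ≤ (4 * p.conjExponent + 3) * ‖v‖ := by
  intro v
  have hp0 : 0 < p := zero_lt_one.trans hp.out
  have hq : 1 < p.conjExponent := (Real.HolderConjugate.conjExponent hp.out).symm.lt
  have hM : (0 : ℝ) < Nat.clog 2 r := by exact_mod_cast Nat.clog_pos one_lt_two hr
  have hMr : (Nat.clog 2 r : ℝ) < r := by exact_mod_cast clog_lt hr
  have hU := normingSup_toEll_le hr hM _ fun A hA =>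
    massSum_combination_le hp0 hr (isProfile_upper hq hr) hu h1 hprof a hA
  have hLo := le_normingSup_toEll hr hM hMr _ fun A hA =>
    (massSum_combination_le hp0 hr (isProfile_lower hr) hu h1 hprof a hA).trans_eq (by norm_num)
  obtain ⟨hK1, hK2⟩ := logb_rpow_mul_inv_clog_rpow hp.out hr
  have hL : 0 ≤ Real.logb 2 r ^ (1 / p) := Real.rpow_nonneg (by linarith [one_le_logb hr]) _
  rw [← tsirelsonNorm_eq hr] at hU hLo
  constructor
  · calc 1 / 16 * ‖v‖ = 1 / 8 * (1 / 2) * ‖v‖ := by ring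
      _ ≤ 1 / 8 * (Real.logb 2 r ^ (1 / p) * (Nat.clog 2 r : ℝ)⁻¹ ^ (1 / p)) * ‖v‖ := by gcongr
      _ = Real.logb 2 r ^ (1 / p) * (1 / 8 * (Nat.clog 2 r : ℝ)⁻¹ ^ (1 / p) * ‖v‖) := by ring
      _ ≤ _ := mul_le_mul_of_nonneg_left hLo hL
  · calc _ ≤ Real.logb 2 r ^ (1 / p) * ((2 + (4 * p.conjExponent + 1 / 2)) *
          (Nat.clog 2 r : ℝ)⁻¹ ^ (1 / p) * ‖v‖) := mul_le_mul_of_nonneg_left hU hL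
      _ = (2 + (4 * p.conjExponent + 1 / 2)) *
          (Real.logb 2 r ^ (1 / p) * (Nat.clog 2 r : ℝ)⁻¹ ^ (1 / p)) * ‖v‖ := by ring
      _ ≤ (2 + (4 * p.conjExponent + 1 / 2)) * 1 * ‖v‖ := by gcongr
      _ ≤ _ := by
        gcongr
        linarith

/-- The modified norm is at most the `ℓ_p`-norm, and `(log₂ r) ^ (1 / p) ≤ Nat.clog 2 r`. The
relative error therefore still amounts to only `1 / 64` after multiplication by that factor, below
the lower constant `1 / 16`. -/
theorem tsirelsonNorm_of_close (hr : 1 < r) {C : ℝ} {v w : Ell p}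
    (h : ‖w - v‖ ≤ 1 / (64 * Nat.clog 2 r) * ‖v‖)
    (hlo : 1 / 16 * ‖v‖ ≤ Real.logb 2 r ^ (1 / p) * tsirelsonNorm p r v)
    (hup : Real.logb 2 r ^ (1 / p) * tsirelsonNorm p r v ≤ C * ‖v‖) (hC : 0 ≤ C) :
    1 / 64 * ‖w‖ ≤ Real.logb 2 r ^ (1 / p) * tsirelsonNorm p r w ∧
      Real.logb 2 r ^ (1 / p) * tsirelsonNorm p r w ≤ 2 * (C + 1) * ‖w‖ := by
  have hp0 : 0 < p := zero_lt_one.trans hp.out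
  have hL := one_le_logb hr
  have hLM := logb_le_clog hr
  set K := Real.logb 2 r ^ (1 / p)
  set M : ℝ := (Nat.clog 2 r : ℝ)
  have hM : 1 ≤ M := by linarith
  have hK0 : 0 ≤ K := Real.rpow_nonneg (by linarith) _
  have hKM : K ≤ M := by
    refine le_trans ?_ hLM
    have hpinv : 1 / p ≤ 1 := by rw [div_le_one hp0]; exact hp.out.le
    exact (Real.rpow_le_rpow_of_exponent_le hL hpinv).trans_eq (Real.rpow_one _)
  have hKe : K * ‖w - v‖ ≤ 1 / 64 * ‖v‖ := by
    calc K * ‖w - v‖ ≤ M * (1 / (64 * M) * ‖v‖) := by gcongr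
      _ = 1 / 64 * ‖v‖ := by field_simp
  have hd : ‖w - v‖ ≤ 1 / 64 * ‖v‖ := by
    refine h.trans ?_
    gcongr
    linarith
  have h1 : ‖v‖ ≤ ‖w‖ + ‖w - v‖ := by
    simpa [norm_sub_rev] using norm_add_le w (v - w)
  have h2 : ‖w‖ ≤ ‖v‖ + ‖w - v‖ := by simpa using norm_add_le v (w - v)
  have hNw : tsirelsonNorm p r w ≤ tsirelsonNorm p r v + ‖w - v‖ := by
    have := tsirelsonNorm_add_le hr v (w - v)
    rw [add_sub_cancel] at this
    linarith [tsirelsonNorm_le_norm hr (w - v)]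
  have hNv : tsirelsonNorm p r v ≤ tsirelsonNorm p r w + ‖w - v‖ := by
    have := tsirelsonNorm_add_le hr w (v - w)
    rw [add_sub_cancel] at this
    have h3 := tsirelsonNorm_le_norm hr (v - w)
    rw [norm_sub_rev] at h3
    linarith
  have hNw' := mul_le_mul_of_nonneg_left hNw hK0
  have hNv' := mul_le_mul_of_nonneg_left hNv hK0
  rw [mul_add] at hNw' hNv'
  have hv0 := norm_nonneg v
  constructor
  · linarith
  · calc K * tsirelsonNorm p r w ≤ (C + 1) * ‖v‖ := by linarith
      _ ≤ (C + 1) * (2 * ‖w‖) := by gcongr; linarith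
      _ = _ := by ring

/-- Every infinite-dimensional subspace of `ℓ_p` has an infinite-dimensional subspace on which the
norm is equivalent to the `ℓ_p`-norm, up to a power of `log r`. -/
theorem exists_subspace_equivalent (hr : 1 < r) (X : Submodule ℝ (Ell p))
    (hX : ¬ FiniteDimensional ℝ X) :
    ∃ Y : Submodule ℝ (Ell p), Y ≤ X ∧ ¬ FiniteDimensional ℝ Y ∧
      (IsClosed (X : Set (Ell p)) → IsClosed (Y : Set (Ell p))) ∧
      ∀ w ∈ Y, 1 / 64 * ‖w‖ ≤ Real.logb 2 r ^ (1 / p) * tsirelsonNorm p r w ∧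
        Real.logb 2 r ^ (1 / p) * tsirelsonNorm p r w ≤ 8 * (p.conjExponent + 1) * ‖w‖ := by
  have hMpos : 0 < Nat.clog 2 r := Nat.clog_pos one_lt_two hr
  have hM1 : (1 : ℝ) ≤ Nat.clog 2 r := by exact_mod_cast hMpos
  have hq : 1 < p.conjExponent := (Real.HolderConjugate.conjExponent hp.out).symm.lt
  set δ : ℝ := 1 / (64 * Nat.clog 2 r) with hδdef
  have hδ0 : 0 < δ := by positivity
  have hδ1 : δ < 1 := by
    rw [hδdef, div_lt_one (by positivity)]
    linarith
  obtain ⟨x, u, hxX, hu1, hud, hxu⟩ := exists_seq_approx_disjoint hX (fun k => δ / 2 / 2 ^ k)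
    fun k => by positivity
  obtain ⟨φ, hφ, hprof⟩ := exists_subseq_bucketMass_close hr u hu1
    (η := 1 / (2 * (Nat.clog 2 r : ℝ) ^ 2)) (by positivity)
  have hu1' : ∀ k, mass p ((u ∘ φ) k) = 1 := fun k => hu1 _
  have hud' : Pairwise fun k l => Disjoint ((u ∘ φ) k).support ((u ∘ φ) l).support :=
    fun k l hkl => hud (hφ.injective.ne hkl)
  have hxu' : ∀ k, ‖(x ∘ φ) k - toEll p ((u ∘ φ) k)‖ ≤ δ / 2 / 2 ^ φ k := fun k => hxu _
  have hsum : ∀ s : Finset ℕ, ∑ k ∈ s, δ / 2 / 2 ^ φ k ≤ δ := fun s => by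
    classical
    rw [← Finset.sum_image (s := s) (g := φ) (f := fun k => δ / 2 / 2 ^ k) hφ.injective.injOn]
    exact sum_le_hasSum _ (fun k _ => by positivity) (hasSum_geometric_two' δ)
  set Y := Submodule.span ℝ (Set.range (block p (Nat.clog 2 r) (x ∘ φ))) with hY
  have hYX : Y ≤ X := by
    refine Submodule.span_le.2 ?_
    rintro _ ⟨n, rfl⟩
    exact X.sum_mem fun a _ => X.smul_mem _ (hxX _)
  have hYinf : ¬ FiniteDimensional ℝ Y := fun hfin => by
    have hli := linearIndependent_span (linearIndependent_block hMpos hud' hu1' hxu' hsum hδ1)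
    have := hli.finite
    exact not_finite ℕ
  have hYest : ∀ w ∈ Y, 1 / 64 * ‖w‖ ≤ Real.logb 2 r ^ (1 / p) * tsirelsonNorm p r w ∧
      Real.logb 2 r ^ (1 / p) * tsirelsonNorm p r w ≤ 8 * (p.conjExponent + 1) * ‖w‖ := by
    intro w hw
    obtain ⟨a, rfl⟩ := Finsupp.mem_span_range_iff_exists_finsupp.1 hw
    obtain ⟨h1, h2⟩ := tsirelsonNorm_combination hr hud' hu1' hprof a
    have h := tsirelsonNorm_of_close hr
      (norm_combination_sub_le hMpos hud' hu1' hxu' hsum a) h1 h2 (by positivity)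
    exact ⟨h.1, h.2.trans_eq (by ring)⟩
  -- If `X` is closed, the closure of the span stays inside it, and both inequalities survive
  -- because the extended norm is continuous.
  by_cases hXc : IsClosed (X : Set (Ell p))
  · refine ⟨Y.topologicalClosure, Y.topologicalClosure_minimal hYX hXc, fun hfin => hYinf ?_,
      fun _ => Y.isClosed_topologicalClosure, fun w hw => ?_⟩
    · exact Submodule.finiteDimensional_of_le Y.le_topologicalClosure
    · have hcont : Continuous (tsirelsonNorm p r) := (isExtension_tsirelsonNorm p hr).1
      refine closure_minimal (s := (Y : Set (Ell p))) (t := {w | 1 / 64 * ‖w‖ ≤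
        Real.logb 2 r ^ (1 / p) * tsirelsonNorm p r w ∧ Real.logb 2 r ^ (1 / p) *
          tsirelsonNorm p r w ≤ 8 * (p.conjExponent + 1) * ‖w‖}) hYest ?_ hw
      exact (isClosed_le (continuous_const.mul continuous_norm) (continuous_const.mul hcont)).inter
        (isClosed_le (continuous_const.mul hcont) (continuous_const.mul continuous_norm))
  · exact ⟨Y, hYX, hYinf, fun h => absurd h hXc, hYest⟩

end Main

/-! ### The stabilization constant and the final constants -/

/-- A function that is equivalent to the norm on a subspace of every infinite-dimensional subspace
has a finite stabilization constant. -/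
theorem stabilizationConstant_le {E : Type*} [NormedAddCommGroup E] [NormedSpace ℝ E] {N : E → ℝ}
    {K c C : ℝ} (hK : 0 < K) (hc : 0 < c)
    (h : ∀ X : Submodule ℝ E, ¬ FiniteDimensional ℝ X →
      ∃ Y : Submodule ℝ E, Y ≤ X ∧ ¬ FiniteDimensional ℝ Y ∧
        ∀ x ∈ Y, c * ‖x‖ ≤ K * N x ∧ K * N x ≤ C * ‖x‖) :
    stabilizationConstant N ≤ ENNReal.ofReal (C / c) := by
  refine iSup₂_le fun X hX => ?_
  obtain ⟨Y, hYX, hY, hN⟩ := h X hX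
  refine (iInf₂_le Y hYX).trans ((iInf_le _ hY).trans ?_)
  refine iSup₂_le fun x y => iSup₂_le fun hx hy => iSup₂_le fun hx1 hy1 => ?_
  have h1 := (hN x hx).2
  have h2 := (hN y hy).1
  rw [hx1, mul_one] at h1
  rw [hy1, mul_one] at h2
  have hNy : 0 < N y := pos_of_mul_pos_right (hc.trans_le h2) hK.le
  rw [← ENNReal.ofReal_div_of_pos hNy]
  refine ENNReal.ofReal_le_ofReal ?_
  -- `N` need not be nonnegative here. When `N x ≤ 0` the quotient is at most zero, and `C ≥ 0`
  -- follows from the two bounds at `y`.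
  rcases le_or_gt (N x) 0 with hx0 | hx0
  · have hC : 0 ≤ C := by
      have h3 := hN y hy
      rw [hy1, mul_one, mul_one] at h3
      linarith
    exact (div_nonpos_of_nonpos_of_nonneg hx0 hNy.le).trans (by positivity)
  · rw [div_le_div_iff₀ hNy hc]
    have h4 : K * N x * c ≤ C * (K * N y) :=
      mul_le_mul h1 h2 hc.le (by nlinarith)
    exact le_of_mul_le_mul_left (by linarith) hK

end ModifiedTsirelson

theorem theorem4p1 (p q : ℝ) [Fact (1 < p)] (hpq : 1 / p + 1 / q = 1) (r : ℕ) (hr : 1 < r) :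
    (∀ X : Submodule ℝ (ModifiedTsirelson.Ell p), ¬ FiniteDimensional ℝ X →
      ∃ Y : Submodule ℝ (ModifiedTsirelson.Ell p), Y ≤ X ∧ ¬ FiniteDimensional ℝ Y ∧
        (IsClosed (X : Set (ModifiedTsirelson.Ell p)) →
          IsClosed (Y : Set (ModifiedTsirelson.Ell p))) ∧
        ∀ x ∈ Y,
          ((4 : ℝ) ^ 6)⁻¹ * ‖x‖ ≤
            Real.logb 2 (r : ℝ) ^ (1 / p) * ModifiedTsirelson.tsirelsonNorm p r x ∧
          Real.logb 2 (r : ℝ) ^ (1 / p) * ModifiedTsirelson.tsirelsonNorm p r x ≤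
            3 * (4 : ℝ) ^ 7 * (p + q) * ‖x‖) ∧
    ModifiedTsirelson.stabilizationConstant (ModifiedTsirelson.tsirelsonNorm p r) ≤
      ENNReal.ofReal (3 * (4 : ℝ) ^ 13 * (p + q)) := by
  have hp : 1 < p := Fact.out
  have hqe : q = p.conjExponent := by
    have h := (Real.HolderConjugate.conjExponent hp).inv_add_inv_eq_one
    rw [one_div, one_div] at hpq
    exact inv_injective (by linarith)
  have hmain : ∀ X : Submodule ℝ (ModifiedTsirelson.Ell p), ¬ FiniteDimensional ℝ X →
      ∃ Y : Submodule ℝ (ModifiedTsirelson.Ell p), Y ≤ X ∧ ¬ FiniteDimensional ℝ Y ∧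
        (IsClosed (X : Set (ModifiedTsirelson.Ell p)) →
          IsClosed (Y : Set (ModifiedTsirelson.Ell p))) ∧
        ∀ x ∈ Y,
          ((4 : ℝ) ^ 6)⁻¹ * ‖x‖ ≤
            Real.logb 2 (r : ℝ) ^ (1 / p) * ModifiedTsirelson.tsirelsonNorm p r x ∧
          Real.logb 2 (r : ℝ) ^ (1 / p) * ModifiedTsirelson.tsirelsonNorm p r x ≤
            3 * (4 : ℝ) ^ 7 * (p + q) * ‖x‖ := by
    intro X hX
    obtain ⟨Y, hYX, hY, hcl, hest⟩ := ModifiedTsirelson.exists_subspace_equivalent hr X hX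
    have hq : 1 < q := hqe ▸ (Real.HolderConjugate.conjExponent hp).symm.lt
    refine ⟨Y, hYX, hY, hcl, fun x hx => ⟨le_trans ?_ (hest x hx).1, (hest x hx).2.trans ?_⟩⟩
    -- The constants found, `1 / 64` and `8 * (q + 1)`, lie well within the required ones, since `64
    -- = 4 ^ 3` and `p, q > 1`.
    · gcongr
      norm_num
    · rw [← hqe]
      refine mul_le_mul_of_nonneg_right ?_ (norm_nonneg _)
      norm_num
      linarith
  refine ⟨hmain, ?_⟩
  have hL := ModifiedTsirelson.one_le_logb hr
  have h := ModifiedTsirelson.stabilizationConstant_le (N := ModifiedTsirelson.tsirelsonNorm p r)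
    (K := Real.logb 2 (r : ℝ) ^ (1 / p)) (c := ((4 : ℝ) ^ 6)⁻¹) (Real.rpow_pos_of_pos (by linarith) _)
    (by positivity) fun X hX => by
      obtain ⟨Y, hYX, hY, -, hest⟩ := hmain X hX
      exact ⟨Y, hYX, hY, hest⟩
  refine h.trans_eq ?_
  congr 1
  norm_num
  ring
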